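/- Let $X$ be a complex Hilbert space and let $A$, with domain $D(A)$, be the generator of a $C_0$-semigroup $(T(t))_{t\ge 0}$ on $X$ that is polynomially stable, i.e. $\sup_{t\ge0}\|T(t)\|<\infty$ and there is $\alpha>0$ with $\|T(t)(I-A)^{-1}\|=O(t^{-1/\alpha})$ as $t\to\infty$. Equip $D(A)$ with the graph norm $\|x\|+\|Ax\|$. Let $C\in\mathcal L(D(A),X)$ commute with every $T(t)$, i.e. for all $t\ge 0$ and $x\in D(A)$ we have $T(t)x\in D(A)$ and $CT(t)x=T(t)Cx$. An operator $E\in\mathcal L(D(A),X)$ satisfies the $2$-Weiss condition for $A$ if there is $K>0$ such that $\|E(\lambda I-A)^{-1}\|\le K(\operatorname{Re}\lambda)^{-1/2}$ for all $\lambda\in\mathbb C$ with $\operatorname{Re}\lambda>0$. Suppose that $C$ satisfies the strong $2$-Weiss condition for $A$: there is $\alpha>0$ such that the operator $C(-A)^{\alpha}$, with domain $\{x\in D((-A)^\alpha):(-A)^\alpha x\in D(A)\}$, extends to an operator in $\mathcal L(D(A),X)$ which satisfies the $2$-Weiss condition for $A$. Here $(-A)^\alpha$ is the fractional power of the sectorial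 operator $-A$. Then for every $t>0$ the operator $CT(t)$, with domain $\{x\in X: T(t)x\in D(A)\}$, extends to a bounded linear operator on $X$ (again denoted by $CT(t)$), and there exist $M>0$ and $\beta>0$ such that $$\|CT(t)\|\le \frac{M}{\sqrt{t^{1+\beta}}}\qquad\text{for all } t>0.$$ -/

import Mathlib

open Set Filter Topology MeasureTheory Asymptotics
open scoped ENNReal

noncomputable section

namespace C0

section Operators

variable {X Y : Type*} [NormedAddCommGroup X] [NormedSpace ℂ X]
  [NormedAddCommGroup Y] [NormedSpace ℂ Y]

/-- A bounded operator `S` commutes with the (possibly unbounded) operator `B`, i.e. `S B ⊂ B S`. -/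
def Commutes (S : X →L[ℂ] X) (B : X →ₗ.[ℂ] X) : Prop :=
  ∀ x : B.domain, ∃ h : S x ∈ B.domain, B ⟨S x, h⟩ = S (B x)

/-- `R = (z I - A)⁻¹` as a bounded operator on `X`. -/
structure IsResolvent (A : X →ₗ.[ℂ] X) (z : ℂ) (R : X →L[ℂ] X) : Prop where
  mem_domain : ∀ x, R x ∈ A.domain
  right_inv : ∀ x, z • R x - A ⟨R x, mem_domain x⟩ = x
  left_inv : ∀ x : A.domain, R (z • (x : X) - A x) = x

theorem IsResolvent.unique {A : X →ₗ.[ℂ] X} {z : ℂ} {R S : X →L[ℂ] X}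
    (hR : IsResolvent A z R) (hS : IsResolvent A z S) : R = S := by
  ext x
  have h := hR.left_inv ⟨S x, hS.mem_domain x⟩
  rwa [hS.right_inv x] at h

/-- The resolvent set `ϱ(A)`. -/
def resSet (A : X →ₗ.[ℂ] X) : Set ℂ := {z | ∃ R, IsResolvent A z R}

open Classical in
/-- The resolvent `R(z, A) = (z I - A)⁻¹` for `z ∈ ϱ(A)` (and `0` outside of `ϱ(A)`). -/
def res (A : X →ₗ.[ℂ] X) (z : ℂ) : X →L[ℂ] X :=
  if h : z ∈ resSet A then Classical.choose h else 0

theorem isResolvent_res {A : X →ₗ.[ℂ] X} {z : ℂ} (h : z ∈ resSet A) :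
    IsResolvent A z (res A z) := by
  rw [res, dif_pos h]
  exact Classical.choose_spec h

theorem res_mem_domain (A : X →ₗ.[ℂ] X) (z : ℂ) (x : X) : res A z x ∈ A.domain := by
  by_cases h : z ∈ resSet A
  · exact (isResolvent_res h).mem_domain x
  · rw [res, dif_neg h]
    exact A.domain.zero_mem

/-- `C ∈ L(D(A), Y)`: the linear map `C` on `D(A)` is bounded for the graph norm `‖x‖ + ‖A x‖`. -/
def GraphBounded (A : X →ₗ.[ℂ] X) (C : A.domain →ₗ[ℂ] Y) : Prop :=
  ∃ c : ℝ, ∀ x : A.domain, ‖C x‖ ≤ c * (‖(x : X)‖ + ‖A x‖)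

/-- The `p`-Weiss condition on `C` for `A`, where `1 ≤ p ≤ ∞` and `1 / ∞ = 0`:
`‖C R(z, A)‖ ≤ K / (Re z) ^ (1 - 1 / p)` for `Re z > 0`. -/
def WeissCondition (p : ℝ≥0∞) (A : X →ₗ.[ℂ] X) (C : A.domain →ₗ[ℂ] Y) : Prop :=
  ∃ K : ℝ, 0 < K ∧ ∀ z : ℂ, 0 < z.re → ∀ x : X,
    ‖C ⟨res A z x, res_mem_domain A z x⟩‖ ≤ K / z.re ^ (1 - (p⁻¹).toReal) * ‖x‖

/-- The domain `D(A ^ n)`: `D(A ^ 0) = X` and `D(A ^ (n + 1)) = {x ∈ D(A) : A x ∈ D(A ^ n)}`. -/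
def domPow (A : X →ₗ.[ℂ] X) : ℕ → Submodule ℂ X
  | 0 => ⊤
  | n + 1 => ((domPow A n).comap A.toFun).map A.domain.subtype

theorem mem_domPow_succ {A : X →ₗ.[ℂ] X} {n : ℕ} {x : X} :
    x ∈ domPow A (n + 1) ↔ ∃ h : x ∈ A.domain, A ⟨x, h⟩ ∈ domPow A n := by
  simp only [domPow, Submodule.mem_map, Submodule.mem_comap, Subtype.exists]
  constructor
  · rintro ⟨y, hy, h, rfl⟩
    exact ⟨hy, h⟩
  · rintro ⟨hx, h⟩
    exact ⟨x, hx, h, rfl⟩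

/-- The integrand `s ^ (α - 1) [(-A) (s - A)⁻¹] ^ n x`, where the bounded operator
`(-A) (s - A)⁻¹` is written as `I - s R(s, A)`. -/
def balakrishnanIntegrand (A : X →ₗ.[ℂ] X) (α : ℝ) (n : ℕ) (x : X) (s : ℝ) : X :=
  ((s ^ (α - 1) : ℝ) : ℂ) • ((1 - (s : ℂ) • res A (s : ℂ)) ^ n) x

theorem balakrishnanIntegrand_zero (A : X →ₗ.[ℂ] X) (α : ℝ) (n : ℕ) :
    balakrishnanIntegrand A α n 0 = fun _ => 0 := by
  funext s
  rw [balakrishnanIntegrand, map_zero, smul_zero]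

theorem balakrishnanIntegrand_add (A : X →ₗ.[ℂ] X) (α : ℝ) (n : ℕ) (x y : X) :
    balakrishnanIntegrand A α n (x + y) =
      fun s => balakrishnanIntegrand A α n x s + balakrishnanIntegrand A α n y s := by
  funext s
  rw [balakrishnanIntegrand, map_add, smul_add]
  rfl

theorem balakrishnanIntegrand_smul (A : X →ₗ.[ℂ] X) (α : ℝ) (n : ℕ) (c : ℂ) (x : X) :
    balakrishnanIntegrand A α n (c • x) = fun s => c • balakrishnanIntegrand A α n x s := by
  funext s
  rw [balakrishnanIntegrand, map_smul, smul_comm]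
  rfl

/-- The Balakrishnan operator: for `α > 0` and the least natural number `n > α`,
`x ↦ Γ(n) / (Γ(α) Γ(n - α)) ∫₀^∞ s ^ (α - 1) [(-A) (s - A)⁻¹] ^ n x ds` for `x ∈ D(A ^ n)`.
For sectorial `-A` the integral converges absolutely at every `x ∈ D(A ^ n)`; the second
condition on the domain makes the definition meaningful for an arbitrary operator. -/
def balakrishnan (A : X →ₗ.[ℂ] X) (α : ℝ) : X →ₗ.[ℂ] X where
  domain :=
    { carrier := {x | x ∈ domPow A (⌊α⌋₊ + 1) ∧
        IntegrableOn (balakrishnanIntegrand A α (⌊α⌋₊ + 1) x) (Ioi 0)}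
      zero_mem' := by
        refine ⟨Submodule.zero_mem _, ?_⟩
        rw [balakrishnanIntegrand_zero]
        exact integrableOn_zero
      add_mem' := by
        rintro x y ⟨hx, hx'⟩ ⟨hy, hy'⟩
        refine ⟨Submodule.add_mem _ hx hy, ?_⟩
        rw [balakrishnanIntegrand_add]
        exact hx'.add hy'
      smul_mem' := by
        rintro c x ⟨hx, hx'⟩
        refine ⟨Submodule.smul_mem _ c hx, ?_⟩
        rw [balakrishnanIntegrand_smul]
        exact hx'.smul c }
  toFun :=
    { toFun := fun x =>
        ((Real.Gamma ((⌊α⌋₊ + 1 : ℕ) : ℝ) /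
            (Real.Gamma α * Real.Gamma (((⌊α⌋₊ + 1 : ℕ) : ℝ) - α)) : ℝ) : ℂ) •
          ∫ s in Ioi (0 : ℝ), balakrishnanIntegrand A α (⌊α⌋₊ + 1) (x : X) s
      map_add' := by
        rintro ⟨x, hx, hx'⟩ ⟨y, hy, hy'⟩
        rw [← smul_add, ← integral_add hx' hy']
        rw [← balakrishnanIntegrand_add]
        rfl
      map_smul' := by
        rintro c ⟨x, hx, hx'⟩
        rw [RingHom.id_apply, smul_comm c, ← integral_smul c]
        rw [← balakrishnanIntegrand_smul A α (⌊α⌋₊ + 1) c x]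
        rfl }

/-- The fractional power `(-A) ^ α`, `α > 0`, of a densely defined operator with `-A` sectorial:
the closure of the Balakrishnan operator. -/
def negFracPow (A : X →ₗ.[ℂ] X) (α : ℝ) : X →ₗ.[ℂ] X :=
  (balakrishnan A α).closure

/-- The strong `2`-Weiss condition on `C` for `A`: for some `α > 0`, the operator `C (-A) ^ α`,
with domain `{x ∈ D((-A) ^ α) : (-A) ^ α x ∈ D(A)}`, extends to some `E ∈ L(D(A), Y)` that
satisfies the `2`-Weiss condition. -/
def StrongTwoWeissCondition (A : X →ₗ.[ℂ] X) (C : A.domain →ₗ[ℂ] Y) : Prop :=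
  ∃ α : ℝ, 0 < α ∧ ∃ E : A.domain →ₗ[ℂ] Y, GraphBounded A E ∧
    (∀ (x : (negFracPow A α).domain) (hx : negFracPow A α x ∈ A.domain),
      ∃ h : (x : X) ∈ A.domain, E ⟨x, h⟩ = C ⟨negFracPow A α x, hx⟩) ∧
    WeissCondition 2 A E

end Operators

/-- A `C₀`-semigroup `(T(t))_{t ≥ 0}` of bounded operators on `X`. The values at `t < 0` carry no
information and are never used. -/
structure Semigroup (X : Type*) [NormedAddCommGroup X] [NormedSpace ℂ X] where
  op : ℝ → X →L[ℂ] X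
  op_zero : op 0 = 1
  op_add : ∀ s t : ℝ, 0 ≤ s → 0 ≤ t → op (s + t) = op s * op t
  tendsto_zero : ∀ x : X, Tendsto (fun t => op t x) (𝓝[>] 0) (𝓝 x)

namespace Semigroup

variable {X : Type*} [NormedAddCommGroup X] [NormedSpace ℂ X]

/-- The difference quotient `(T(t) x - x) / t`. -/
def diffQuot (T : Semigroup X) (x : X) (t : ℝ) : X :=
  ((t⁻¹ : ℝ) : ℂ) • (T.op t x - x)

theorem diffQuot_add (T : Semigroup X) (x y : X) :
    T.diffQuot (x + y) = fun t => T.diffQuot x t + T.diffQuot y t := by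
  funext t
  simp only [diffQuot, map_add, ← smul_add]
  congr 1
  abel

theorem diffQuot_smul (T : Semigroup X) (c : ℂ) (x : X) :
    T.diffQuot (c • x) = fun t => c • T.diffQuot x t := by
  funext t
  simp only [diffQuot, map_smul, ← smul_sub, smul_comm c]

/-- The infinitesimal generator of the semigroup: `A x = lim_{t → 0+} (T(t) x - x) / t`, on the
domain of all `x` for which the limit exists. -/
def generator (T : Semigroup X) : X →ₗ.[ℂ] X where
  domain :=
    { carrier := {x | ∃ y, Tendsto (T.diffQuot x) (𝓝[>] 0) (𝓝 y)}
      zero_mem' := ⟨0, by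
        have : T.diffQuot 0 = fun _ => 0 := by funext t; simp [diffQuot]
        rw [this]
        exact tendsto_const_nhds⟩
      add_mem' := by
        rintro x y ⟨u, hu⟩ ⟨v, hv⟩
        exact ⟨u + v, by rw [diffQuot_add]; exact hu.add hv⟩
      smul_mem' := by
        rintro c x ⟨u, hu⟩
        exact ⟨c • u, by rw [diffQuot_smul]; exact hu.const_smul c⟩ }
  toFun :=
    { toFun := fun x => Classical.choose x.2
      map_add' := fun x y => by
        refine tendsto_nhds_unique (Classical.choose_spec (x + y).2) ?_
        have h := (Classical.choose_spec x.2).add (Classical.choose_spec y.2)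
        rwa [← diffQuot_add] at h
      map_smul' := fun c x => by
        refine tendsto_nhds_unique (Classical.choose_spec (c • x).2) ?_
        have h := (Classical.choose_spec x.2).const_smul c
        rwa [← diffQuot_smul] at h }

theorem tendsto_generator (T : Semigroup X) (x : T.generator.domain) :
    Tendsto (T.diffQuot x) (𝓝[>] 0) (𝓝 (T.generator x)) :=
  Classical.choose_spec x.2

/-- The semigroup is bounded: `sup_{t ≥ 0} ‖T(t)‖ < ∞`. -/
def IsBounded (T : Semigroup X) : Prop :=
  ∃ M : ℝ, ∀ t : ℝ, 0 ≤ t → ‖T.op t‖ ≤ M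

/-- The semigroup is polynomially stable: it is bounded and, for some `α > 0`,
`‖T(t) (I - A)⁻¹‖ = O(t ^ (-1 / α))` as `t → ∞`. -/
def IsPolynomiallyStable (T : Semigroup X) : Prop :=
  T.IsBounded ∧ ∃ α : ℝ, 0 < α ∧
    (fun t : ℝ => ‖T.op t ∘L res T.generator 1‖) =O[atTop] fun t : ℝ => t ^ (-(1 / α))

end Semigroup

end C0

end

/-! Uniform decay of `T(t) R(1, A)` puts `0` in the resolvent set (`zero_mem_resSet`). With `Q =
(-A)⁻¹`, the operators `C` and `E = C (-A) ^ α` on `D(A)` are encoded by the bounded operators `V =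
C Q` and `W = E Q`, which commute with the semigroup.

Two estimates are multiplied. The Hilbert space enters in `norm_apply_op_le_of_weiss`: the Laplace
transforms of `s ↦ s E T(s) y` and `s ↦ T(s) y` are `E R(z, A) ^ 2 y` and `R(z, A) y`, so the Weiss
bound on a vertical line and Plancherel's theorem compare the two weighted orbits in `L²`, which
gives `‖E T(t)‖ = O(t ^ (-1 / 2))`. Next, `exists_factor` writes `C = E G` with `G = (-A) ^ (-α)`,
and interpolation of resolvent bounds turns polynomial stability into `‖T(t) G‖ = O(t ^ (-ε))`. Then
`C T(t) = E T(t / 2) · T(t / 2) G` decays like `t ^ (-1 / 2 - ε)`, so `β = 2 ε`.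

Fractional powers are handled by explicit integrals. For `k` large, `‖T(t) Q ^ k‖` is `O((1 + t) ^
(-2))` and `∫ t ^ (a - 1) T(t) Q ^ k dt` represents `Γ(a) (-A) ^ (-a - k)`. Fubini's theorem
identifies Balakrishnan's integral with such operators, the Beta integral multiplies them, and `Q ^
k` is cancelled at the end because its range is dense (`eq_of_mul_inverse_pow`). -/

namespace C0

/-! ### Bounded semigroups: continuity, generator and weighted averages -/

section Basic

variable {X : Type*} [NormedAddCommGroup X] [NormedSpace ℂ X]

theorem IsResolvent.res_eq {A : X →ₗ.[ℂ] X} {z : ℂ} {R : X →L[ℂ] X} (h : IsResolvent A z R) :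
    res A z = R :=
  (isResolvent_res ⟨R, h⟩).unique h

/-- The semigroup law bounds an increment over `[s, t]` by one over `[0, t - s]`, so right
continuity at `0` propagates. It is used for orbits and, in operator norm, for `T(t) Q`. -/
theorem continuousOn_of_tendsto_zero {E : Type*} [NormedAddCommGroup E] {f : ℝ → E}
    {M : ℝ}
    (hf : ∀ s t, 0 ≤ s → s ≤ t → ‖f t - f s‖ ≤ M * ‖f (t - s) - f 0‖)
    (h0 : Tendsto f (𝓝[>] 0) (𝓝 (f 0))) : ContinuousOn f (Ici 0) := by
  have h1 : Tendsto f (𝓝[≥] 0) (𝓝 (f 0)) := continuousWithinAt_Ioi_iff_Ici.1 h0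
  have hf' : ∀ s t, 0 ≤ s → 0 ≤ t → ‖f t - f s‖ ≤ M * ‖f |t - s| - f 0‖ := by
    intro s t hs ht
    rcases le_total s t with h | h
    · rw [abs_of_nonneg (sub_nonneg.2 h)]; exact hf s t hs h
    · rw [abs_sub_comm, abs_of_nonneg (sub_nonneg.2 h), norm_sub_rev]; exact hf t s ht h
  intro s hs
  have h2 : Tendsto (fun t => |t - s|) (𝓝[≥] s ⊔ 𝓝[Ici 0] s) (𝓝[≥] 0) := by
    refine tendsto_nhdsWithin_iff.2 ⟨?_, Eventually.of_forall fun t => mem_Ici.2 (abs_nonneg _)⟩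
    have : Tendsto (fun t => |t - s|) (𝓝 s) (𝓝 |s - s|) := by
      exact (continuous_abs.comp (continuous_id.sub continuous_const)).tendsto s
    rw [sub_self, abs_zero] at this
    exact this.mono_left (sup_le nhdsWithin_le_nhds nhdsWithin_le_nhds)
  have h3 := ((h1.comp (h2.mono_left le_sup_right)).sub_const (f 0)).norm.const_mul M
  rw [sub_self, norm_zero, mul_zero] at h3
  rw [ContinuousWithinAt, tendsto_iff_norm_sub_tendsto_zero]
  refine squeeze_zero' (Eventually.of_forall fun _ => norm_nonneg _) ?_ h3
  filter_upwards [self_mem_nhdsWithin] with t ht using hf' s t hs ht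

namespace Semigroup

variable (T : Semigroup X)

theorem op_add_apply {s t : ℝ} (hs : 0 ≤ s) (ht : 0 ≤ t) (x : X) :
    T.op (s + t) x = T.op s (T.op t x) := by
  rw [T.op_add s t hs ht]; rfl

theorem op_commute {s t : ℝ} (hs : 0 ≤ s) (ht : 0 ≤ t) : Commute (T.op s) (T.op t) := by
  rw [Commute, SemiconjBy, ← T.op_add s t hs ht, ← T.op_add t s ht hs, add_comm]

theorem generator_eq_of_tendsto {x y : X} (h : Tendsto (T.diffQuot x) (𝓝[>] 0) (𝓝 y)) :
    ∃ hx : x ∈ T.generator.domain, T.generator ⟨x, hx⟩ = y :=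
  ⟨⟨y, h⟩, tendsto_nhds_unique (T.tendsto_generator ⟨x, ⟨y, h⟩⟩) h⟩

/-- A bounded operator that commutes with the semigroup commutes with its generator. -/
theorem commutes_generator {S : X →L[ℂ] X} (hS : ∀ t, 0 ≤ t → Commute S (T.op t)) :
    Commutes S T.generator := by
  intro x
  refine T.generator_eq_of_tendsto ?_
  refine ((S.continuous.tendsto _).comp (T.tendsto_generator x)).congr' ?_
  filter_upwards [self_mem_nhdsWithin] with t ht
  have h : S (T.op t x) = T.op t (S x) := DFunLike.congr_fun (hS t (le_of_lt ht)) (x : X)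
  simp [diffQuot, h]

variable {T} {M : ℝ} (hM : ∀ t, 0 ≤ t → ‖T.op t‖ ≤ M)
include hM

theorem bound_nonneg : 0 ≤ M := (norm_nonneg _).trans (hM 0 le_rfl)

theorem norm_op_apply_le {t : ℝ} (ht : 0 ≤ t) (x : X) : ‖T.op t x‖ ≤ M * ‖x‖ :=
  (T.op t).le_of_opNorm_le (hM t ht) x

theorem continuousOn_op_apply (x : X) : ContinuousOn (fun t => T.op t x) (Ici 0) := by
  refine continuousOn_of_tendsto_zero (M := M) (fun s t hs hst => ?_) ?_
  · have : T.op t x - T.op s x = T.op s (T.op (t - s) x - T.op 0 x) := by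
      rw [map_sub, ← T.op_add_apply hs (sub_nonneg.2 hst), ← T.op_add_apply hs le_rfl]
      simp
    rw [this]
    exact norm_op_apply_le hM hs _
  · simpa [T.op_zero] using T.tendsto_zero x

theorem integrableOn_smul_op_apply {φ : ℝ → ℂ} (hφ : IntegrableOn φ (Ioi 0)) (x : X) :
    IntegrableOn (fun t => φ t • T.op t x) (Ioi 0) := by
  refine Integrable.mono' (hφ.norm.mul_const (M * ‖x‖)) ?_ ?_
  · exact hφ.aestronglyMeasurable.smul (((continuousOn_op_apply hM x).mono
      Ioi_subset_Ici_self).aestronglyMeasurable measurableSet_Ioi)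
  · filter_upwards [ae_restrict_mem measurableSet_Ioi] with t ht
    rw [norm_smul]
    exact mul_le_mul_of_nonneg_left (norm_op_apply_le hM (le_of_lt ht) x) (norm_nonneg _)

theorem exists_integral_op {φ : ℝ → ℂ} (hφ : IntegrableOn φ (Ioi 0)) :
    ∃ S : X →L[ℂ] X, (∀ x, S x = ∫ t in Ioi (0 : ℝ), φ t • T.op t x) ∧
      ‖S‖ ≤ M * ∫ t in Ioi (0 : ℝ), ‖φ t‖ := by
  have hb := mul_nonneg (bound_nonneg hM)
    (integral_nonneg (μ := volume.restrict (Ioi (0 : ℝ))) fun t => norm_nonneg (φ t))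
  refine ⟨LinearMap.mkContinuous
    { toFun := fun x => ∫ t in Ioi (0 : ℝ), φ t • T.op t x
      map_add' := fun x y => ?_
      map_smul' := fun c x => ?_ } (M * ∫ t in Ioi (0 : ℝ), ‖φ t‖) fun x => ?_, fun x => rfl,
      LinearMap.mkContinuous_norm_le _ hb _⟩
  · rw [← integral_add (integrableOn_smul_op_apply hM hφ x) (integrableOn_smul_op_apply hM hφ y)]
    simp
  · rw [RingHom.id_apply, ← integral_smul]
    simp [smul_comm c]
  · calc ‖∫ t in Ioi (0 : ℝ), φ t • T.op t x‖ ≤ ∫ t in Ioi (0 : ℝ), ‖φ t‖ * (M * ‖x‖) := by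
          refine norm_integral_le_of_norm_le (hφ.norm.mul_const _) ?_
          filter_upwards [ae_restrict_mem measurableSet_Ioi] with t ht
          rw [norm_smul]
          exact mul_le_mul_of_nonneg_left (norm_op_apply_le hM (le_of_lt ht) x) (norm_nonneg _)
      _ = (M * ∫ t in Ioi (0 : ℝ), ‖φ t‖) * ‖x‖ := by rw [integral_mul_const]; ring

end Semigroup

end Basic

/-! ### The resolvent as a Laplace transform -/

section Resolvent

variable {X : Type*} [NormedAddCommGroup X] [NormedSpace ℂ X] [CompleteSpace X]

theorem integrableOn_cexp_neg_mul {z : ℂ} (hz : 0 < z.re) :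
    IntegrableOn (fun t : ℝ => Complex.exp (-z * t)) (Ioi 0) :=
  integrableOn_exp_mul_complex_Ioi (by simpa using hz) 0

namespace Semigroup

variable {T : Semigroup X} {M : ℝ} (hM : ∀ t, 0 ≤ t → ‖T.op t‖ ≤ M)

theorem commute_integral_op {φ : ℝ → ℂ} {S B : X →L[ℂ] X} (hφ : IntegrableOn φ (Ioi 0))
    (hM : ∀ t, 0 ≤ t → ‖T.op t‖ ≤ M)
    (hS : ∀ x, S x = ∫ t in Ioi (0 : ℝ), φ t • T.op t x) (hB : ∀ t, 0 ≤ t → Commute B (T.op t)) :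
    Commute B S := by
  ext x
  change B (S x) = S (B x)
  rw [hS, hS, ← B.integral_comp_comm (integrableOn_smul_op_apply hM hφ x)]
  refine setIntegral_congr_fun measurableSet_Ioi fun t ht => ?_
  have h : B (T.op t x) = T.op t (B x) := DFunLike.congr_fun (hB t (le_of_lt ht)) x
  simp [h]

include hM

/-- Applying `T(h)` shifts the orbit by `h`: the transform is multiplied by `e ^ (z h)` and loses
the piece over `[0, h]`. -/
theorem op_laplace {z : ℂ} (hz : 0 < z.re) (x : X) {h : ℝ} (hh : 0 ≤ h) :
    T.op h (∫ t in Ioi (0 : ℝ), Complex.exp (-z * t) • T.op t x) =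
      Complex.exp (z * h) • ((∫ t in Ioi (0 : ℝ), Complex.exp (-z * t) • T.op t x) -
        ∫ t in (0 : ℝ)..h, Complex.exp (-z * t) • T.op t x) := by
  have hi := integrableOn_smul_op_apply hM (integrableOn_cexp_neg_mul hz) x
  have h1 : (∫ t in Ioi (0 : ℝ), Complex.exp (-z * t) • T.op t x) -
      (∫ t in (0 : ℝ)..h, Complex.exp (-z * t) • T.op t x) =
      ∫ t in Ioi h, Complex.exp (-z * t) • T.op t x := by
    rw [sub_eq_iff_eq_add, intervalIntegral.integral_of_le hh, add_comm,
      ← setIntegral_union (Ioc_disjoint_Ioi le_rfl) measurableSet_Ioi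
        (hi.mono_set Ioc_subset_Ioi_self) (hi.mono_set (Ioi_subset_Ioi hh)),
      Ioc_union_Ioi_eq_Ioi hh]
  have h2 : ∫ t in Ioi h, Complex.exp (-z * t) • T.op t x =
      ∫ t in Ioi (0 : ℝ), Complex.exp (-z * ((t + h : ℝ) : ℂ)) • T.op (t + h) x := by
    have he : MeasurableEmbedding (fun t : ℝ => t + h) := measurableEmbedding_addRight h
    have := (measurePreserving_add_right (volume : Measure ℝ) h).setIntegral_preimage_emb he
      (fun t : ℝ => Complex.exp (-z * t) • T.op t x) (Ioi h)
    simpa using this.symm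
  rw [h1, h2, ← (T.op h).integral_comp_comm hi, ← integral_smul]
  refine setIntegral_congr_fun measurableSet_Ioi fun t ht => ?_
  rw [map_smul, smul_smul, ← Complex.exp_add, ← T.op_add_apply hh (le_of_lt ht), add_comm h t]
  congr 2
  push_cast
  ring

theorem isResolvent_laplace {z : ℂ} (hz : 0 < z.re) {S : X →L[ℂ] X}
    (hS : ∀ x, S x = ∫ t in Ioi (0 : ℝ), Complex.exp (-z * t) • T.op t x) :
    IsResolvent T.generator z S := by
  have key : ∀ x, ∃ hx : S x ∈ T.generator.domain, T.generator ⟨S x, hx⟩ = z • S x - x := by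
    intro x
    refine T.generator_eq_of_tendsto ?_
    have hc : ContinuousOn (fun t : ℝ => Complex.exp (-z * t) • T.op t x) (Ici 0) :=
      (Continuous.continuousOn (by fun_prop)).smul (continuousOn_op_apply hM x)
    have hd : HasDerivWithinAt (fun h : ℝ => ∫ t in (0 : ℝ)..h, Complex.exp (-z * t) • T.op t x)
        (Complex.exp (-z * (0 : ℝ)) • T.op 0 x) (Ici 0) 0 := by
      refine intervalIntegral.integral_hasDerivWithinAt_right (by simp) (t := Ioi 0) ?_ ?_
      · exact ⟨Ioi 0, self_mem_nhdsWithin,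
          (hc.mono Ioi_subset_Ici_self).aestronglyMeasurable measurableSet_Ioi⟩
      · exact (hc 0 self_mem_Ici).mono Ioi_subset_Ici_self
    have he : HasDerivWithinAt (fun h : ℝ => Complex.exp (z * h)) (Complex.exp (z * (0 : ℝ)) * z)
        (Ici 0) 0 := by
      have := ((hasDerivAt_id (0 : ℝ)).ofReal_comp.const_mul z).cexp
      simpa using this.hasDerivWithinAt
    -- By `op_laplace` this product is `T(h) S x` for `h > 0`, so its right derivative at `0` is the
    -- generator applied to `S x`.
    have hu := he.fun_smul (hd.const_sub (S x))
    have hu' := (hasDerivWithinAt_iff_tendsto_slope' (by simp)).1 (hu.mono Ioi_subset_Ici_self)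
    have hval : Complex.exp (z * (0 : ℝ)) • -(Complex.exp (-z * (0 : ℝ)) • T.op 0 x) +
        (Complex.exp (z * (0 : ℝ)) * z) •
          (S x - ∫ t in (0 : ℝ)..(0 : ℝ), Complex.exp (-z * t) • T.op t x) = z • S x - x := by
      simp [T.op_zero]; abel
    rw [hval] at hu'
    refine hu'.congr' ?_
    filter_upwards [self_mem_nhdsWithin] with h hh
    have := op_laplace hM hz x (le_of_lt hh)
    rw [← hS] at this
    simp only [slope, diffQuot, this, ← Complex.coe_smul]
    simp
  have hcomm : Commutes S T.generator := T.commutes_generator fun t ht =>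
    (commute_integral_op (integrableOn_cexp_neg_mul hz) hM hS fun s hs => T.op_commute ht hs).symm
  refine ⟨fun x => (key x).1, fun x => ?_, fun x => ?_⟩
  · rw [(key x).2]; abel
  · obtain ⟨h1, h2⟩ := hcomm x
    rw [map_sub, map_smul, ← h2, (key x).2]
    abel

theorem mem_resSet {z : ℂ} (hz : 0 < z.re) : z ∈ resSet T.generator := by
  obtain ⟨S, hS, -⟩ := exists_integral_op hM (integrableOn_cexp_neg_mul hz)
  exact ⟨S, isResolvent_laplace hM hz hS⟩

theorem isResolvent_res {z : ℂ} (hz : 0 < z.re) :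
    IsResolvent T.generator z (res T.generator z) :=
  C0.isResolvent_res (mem_resSet hM hz)

theorem res_apply {z : ℂ} (hz : 0 < z.re) (x : X) :
    res T.generator z x = ∫ t in Ioi (0 : ℝ), Complex.exp (-z * t) • T.op t x := by
  obtain ⟨S, hS, -⟩ := exists_integral_op hM (integrableOn_cexp_neg_mul hz)
  rw [(isResolvent_laplace hM hz hS).res_eq, hS]

theorem norm_res_le {z : ℂ} (hz : 0 < z.re) : ‖res T.generator z‖ ≤ M / z.re := by
  obtain ⟨S, hS, hn⟩ := exists_integral_op hM (integrableOn_cexp_neg_mul hz)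
  rw [(isResolvent_laplace hM hz hS).res_eq]
  have h : ∫ t in Ioi (0 : ℝ), ‖Complex.exp (-z * t)‖ = 1 / z.re := by
    have := integral_exp_mul_Ioi (a := -z.re) (by simpa using hz) 0
    simpa [Complex.norm_exp] using this
  rwa [h, mul_one_div] at hn

theorem commute_res {z : ℂ} (hz : 0 < z.re) {B : X →L[ℂ] X}
    (hB : ∀ t, 0 ≤ t → Commute B (T.op t)) : Commute B (res T.generator z) :=
  commute_integral_op (integrableOn_cexp_neg_mul hz) hM (res_apply hM hz) hB

/-- The substitution `u = r t` makes `r R(r, A) x` an average of `T(u / r) x` against `e ^ (-u)`,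
and dominated convergence applies. Density of `D(A)` follows. -/
theorem tendsto_res_smul (x : X) :
    Tendsto (fun r : ℝ => (r : ℂ) • res T.generator (r : ℂ) x) atTop (𝓝 x) := by
  have h1 : ∀ r : ℝ, 0 < r → (r : ℂ) • res T.generator (r : ℂ) x =
      ∫ u in Ioi (0 : ℝ), Complex.exp (-u) • T.op (r⁻¹ * u) x := by
    intro r hr
    have := integral_comp_mul_left_Ioi (fun t : ℝ => Complex.exp (-r * t) • T.op t x) 0
      (inv_pos.2 hr)
    rw [mul_zero, inv_inv, ← res_apply hM (by simpa using hr)] at this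
    rw [← Complex.coe_smul] at this
    rw [← this]
    refine setIntegral_congr_fun measurableSet_Ioi fun u _ => ?_
    have : (r : ℂ) ≠ 0 := by exact_mod_cast hr.ne'
    congr 2
    push_cast
    field_simp
  have h2 : Tendsto (fun r : ℝ => ∫ u in Ioi (0 : ℝ), Complex.exp (-u) • T.op (r⁻¹ * u) x) atTop
      (𝓝 (∫ u in Ioi (0 : ℝ), Complex.exp (-u) • x)) := by
    have hint : IntegrableOn (fun u : ℝ => Complex.exp (-u)) (Ioi 0) := by
      simpa using integrableOn_cexp_neg_mul (z := 1) (by simp)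
    refine tendsto_integral_filter_of_dominated_convergence
      (fun u : ℝ => ‖Complex.exp (-u)‖ * (M * ‖x‖)) ?_ ?_ (hint.norm.mul_const _) ?_
    · filter_upwards [eventually_gt_atTop 0] with r hr
      refine ContinuousOn.aestronglyMeasurable ?_ measurableSet_Ioi
      refine (Continuous.continuousOn (by fun_prop)).smul ?_
      refine (continuousOn_op_apply hM x).comp (Continuous.continuousOn (by fun_prop)) ?_
      intro u hu
      exact mul_nonneg (inv_pos.2 hr).le (le_of_lt hu)
    · filter_upwards [eventually_gt_atTop 0] with r hr
      filter_upwards [ae_restrict_mem measurableSet_Ioi] with u hu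
      rw [norm_smul]
      exact mul_le_mul_of_nonneg_left
        (norm_op_apply_le hM (mul_nonneg (inv_pos.2 hr).le (le_of_lt hu)) x) (norm_nonneg _)
    · filter_upwards [ae_restrict_mem measurableSet_Ioi] with u hu
      refine Tendsto.const_smul ?_ _
      refine (T.tendsto_zero x).comp (tendsto_nhdsWithin_iff.2 ⟨?_, ?_⟩)
      · simpa using (tendsto_inv_atTop_zero (𝕜 := ℝ)).mul_const u
      · filter_upwards [eventually_gt_atTop 0] with r hr using mul_pos (inv_pos.2 hr) hu
  have h3 : ∫ u in Ioi (0 : ℝ), Complex.exp (-u) • x = x := by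
    rw [integral_smul_const]
    have : ∫ u in Ioi (0 : ℝ), Complex.exp (-(u : ℂ)) = 1 := by
      have h := integral_exp_neg_Ioi 0
      rw [neg_zero, Real.exp_zero] at h
      have h' := integral_ofReal (f := fun u : ℝ => Real.exp (-u))
        (μ := volume.restrict (Ioi (0 : ℝ))) (𝕜 := ℂ)
      rw [h] at h'
      simpa using h'
    rw [this, one_smul]
  rw [h3] at h2
  refine h2.congr' ?_
  filter_upwards [eventually_gt_atTop 0] with r hr using (h1 r hr).symm

theorem dense_domain : Dense (T.generator.domain : Set X) := by
  intro x
  refine mem_closure_of_tendsto (tendsto_res_smul hM x) (Eventually.of_forall fun r => ?_)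
  exact T.generator.domain.smul_mem _ (res_mem_domain _ _ _)

end Semigroup

end Resolvent

/-! ### Algebra of the inverse `Q = (-A)⁻¹` -/

section Inverse

variable {X : Type*} [NormedAddCommGroup X] [NormedSpace ℂ X]

section

variable {A : X →ₗ.[ℂ] X} {Q : X →L[ℂ] X} (hQ : IsResolvent A 0 Q)
include hQ

theorem IsResolvent.apply_zero (x : X) : A ⟨Q x, hQ.mem_domain x⟩ = -x := by
  have := hQ.right_inv x
  rw [zero_smul, zero_sub] at this
  exact neg_eq_iff_eq_neg.1 this

theorem IsResolvent.zero_apply (x : A.domain) : Q (A x) = -x := by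
  have := hQ.left_inv x
  rw [zero_smul, zero_sub, map_neg] at this
  rw [← this, neg_neg]

theorem IsResolvent.eq_zero_apply (x : A.domain) : (x : X) = Q (-A x) := by
  rw [map_neg, hQ.zero_apply, neg_neg]

theorem IsResolvent.injective_zero : Function.Injective Q := by
  intro x y h
  have h1 := hQ.apply_zero x
  simp only [h] at h1
  rw [hQ.apply_zero y] at h1
  exact (neg_injective h1).symm

theorem IsResolvent.commute_of_commutes {B : X →L[ℂ] X} (hB : Commutes B A) : Commute B Q := by
  ext x
  change B (Q x) = Q (B x)
  obtain ⟨h1, h2⟩ := hB ⟨Q x, hQ.mem_domain x⟩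
  rw [hQ.apply_zero, map_neg] at h2
  have := hQ.zero_apply ⟨_, h1⟩
  rw [h2, map_neg] at this
  exact (neg_injective this).symm

/-- Here `1 - z R` is `-A R`, so `Q` undoes the factor `-A`. This form keeps every computation among
bounded operators. -/
theorem IsResolvent.one_sub_smul_mul {z : ℂ} {R : X →L[ℂ] X} (hR : IsResolvent A z R) :
    (1 - z • R) * Q = R := by
  ext x
  have := hR.left_inv ⟨Q x, hQ.mem_domain x⟩
  rw [hQ.apply_zero, sub_neg_eq_add, map_add, map_smul] at this
  change Q x - z • R (Q x) = R x
  rw [sub_eq_iff_eq_add, add_comm]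
  exact this.symm

theorem IsResolvent.pow_mem_domPow (n : ℕ) (x : X) : (Q ^ n) x ∈ domPow A n := by
  induction n generalizing x with
  | zero => exact Submodule.mem_top
  | succ n ih =>
    rw [mem_domPow_succ]
    have h : (Q ^ (n + 1)) x = Q ((Q ^ n) x) := by rw [pow_succ']; rfl
    simp only [h]
    refine ⟨hQ.mem_domain _, ?_⟩
    rw [hQ.apply_zero]
    exact Submodule.neg_mem _ (ih x)

end

end Inverse

/-! ### Polynomial stability: invertibility of the generator and decay rates -/

section Stability

variable {X : Type*} [NormedAddCommGroup X] [NormedSpace ℂ X] [CompleteSpace X]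

namespace Semigroup

variable {T : Semigroup X} {M : ℝ} (hM : ∀ t, 0 ≤ t → ‖T.op t‖ ≤ M)
include hM

/-- By `op_laplace` the difference is `(e ^ (r h) - 1) R(r, A)` minus `e ^ (r h)` times an integral
over `[0, h]`. The bound times `r` vanishes as `r → 0` with `h` fixed, and the bound itself vanishes
as `h → 0` with `r` fixed; both limits are needed. -/
theorem norm_op_mul_res_sub_le {r h : ℝ} (hr : 0 < r) (hh : 0 ≤ h) :
    ‖T.op h * res T.generator r - res T.generator r‖ ≤
      M * ((Real.exp (r * h) - 1) / r + Real.exp (r * h) * h) := by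
  have hr' : 0 < (r : ℂ).re := by simpa using hr
  have hM0 := bound_nonneg hM
  have he : 0 ≤ Real.exp (r * h) - 1 := sub_nonneg.2 (Real.one_le_exp (by positivity))
  refine ContinuousLinearMap.opNorm_le_bound _ (by positivity) fun x => ?_
  have h0 : (T.op h * res T.generator r - res T.generator r) x =
      (((Real.exp (r * h) - 1 : ℝ)) : ℂ) • res T.generator r x - ((Real.exp (r * h) : ℝ) : ℂ) •
        ∫ t in (0 : ℝ)..h, Complex.exp (-r * t) • T.op t x := by
    have := op_laplace hM hr' x hh
    rw [← res_apply hM hr'] at this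
    change T.op h (res T.generator r x) - res T.generator r x = _
    rw [this]
    push_cast
    rw [smul_sub, sub_smul, one_smul]
    abel
  have h1 : ‖∫ t in (0 : ℝ)..h, Complex.exp (-r * t) • T.op t x‖ ≤ (M * ‖x‖) * |h - 0| := by
    refine intervalIntegral.norm_integral_le_of_norm_le_const fun t ht => ?_
    rw [uIoc_of_le hh] at ht
    rw [norm_smul, Complex.norm_exp]
    refine (mul_le_mul (Real.exp_le_one_iff.2 ?_) (norm_op_apply_le hM ht.1.le x)
      (norm_nonneg _) zero_le_one).trans (one_mul _).le
    have := mul_pos hr ht.1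
    simp only [Complex.mul_re, Complex.neg_re, Complex.ofReal_re, Complex.neg_im,
      Complex.ofReal_im]
    linarith
  rw [sub_zero, abs_of_nonneg hh] at h1
  rw [h0]
  refine (norm_sub_le _ _).trans ?_
  rw [norm_smul, norm_smul, Complex.norm_real, Complex.norm_real, Real.norm_of_nonneg he,
    Real.norm_of_nonneg (Real.exp_pos _).le]
  have h2 : ‖res T.generator r x‖ ≤ M / r * ‖x‖ := by
    have := (res T.generator (r : ℂ)).le_of_opNorm_le (norm_res_le hM hr') x
    simpa using this
  calc _ ≤ (Real.exp (r * h) - 1) * (M / r * ‖x‖) + Real.exp (r * h) * (M * ‖x‖ * h) := by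
        gcongr
    _ = _ := by ring

/-- If the orbits starting in the domain decay uniformly, the generator is invertible. -/
theorem zero_mem_resSet (h : Tendsto (fun t => ‖T.op t * res T.generator 1‖) atTop (𝓝 0)) :
    ∃ Q, IsResolvent T.generator 0 Q := by
  have hM0 := bound_nonneg hM
  set R := res T.generator 1 with hR
  have hR1 : IsResolvent T.generator 1 R := isResolvent_res hM (by simp)
  obtain ⟨τ, hτ, hτ0⟩ : ∃ τ, ‖T.op τ * R‖ * M < 1 / 2 ∧ 0 ≤ τ := by
    have := h.mul_const M
    rw [zero_mul] at this
    exact ((this.eventually_lt_const (by norm_num)).and (eventually_ge_atTop 0)).exists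
  obtain ⟨r, hr, hr0⟩ : ∃ r : ℝ, M * ((Real.exp (r * τ) - 1) + r * (Real.exp (r * τ) * τ)) * ‖R‖
      < 1 / 2 ∧ 0 < r := by
    have hc : Continuous fun r : ℝ =>
        M * ((Real.exp (r * τ) - 1) + r * (Real.exp (r * τ) * τ)) * ‖R‖ := by fun_prop
    have := (hc.tendsto 0).mono_left (nhdsWithin_le_nhds (s := Ioi 0))
    simp only [zero_mul, Real.exp_zero, sub_self, add_zero, mul_zero] at this
    exact ((this.eventually_lt_const (by norm_num)).and self_mem_nhdsWithin).exists
  have hr' : 0 < (r : ℂ).re := by simpa using hr0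
  set S := res T.generator r with hS
  have hSr : IsResolvent T.generator r S := isResolvent_res hM hr'
  have hA : ∀ x, T.generator ⟨R x, hR1.mem_domain x⟩ = R x - x := fun x => by
    have h3 := hR1.right_inv x
    rw [one_smul, sub_eq_iff_eq_add, add_comm] at h3
    exact eq_sub_of_add_eq h3.symm
  have hSR : Commute S R := commute_res hM (by simp) fun t ht =>
    (commute_res hM hr' fun s hs => T.op_commute ht hs).symm
  have hTS : Commute (T.op τ) S := commute_res hM hr' fun s hs => T.op_commute hτ0 hs
  have hrS : ‖(r : ℂ) • S‖ ≤ M := by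
    rw [norm_smul, Complex.norm_real, Real.norm_of_nonneg hr0.le]
    have := norm_res_le hM hr'
    rw [Complex.ofReal_re, le_div_iff₀ hr0] at this
    linarith
  -- Since `A R = R - 1`, inverting `A` amounts to inverting `1 - R`. As `(S + 1) (1 - R) = 1 - D`,
  -- a Neumann series does this once `‖D‖ < 1`.
  set D := (r : ℂ) • S * R with hD
  have hD1 : ‖D‖ < 1 := by
    -- The first term is at most `M ‖T(τ) R‖`, small for large `τ`; the second is small for small
    -- `r` once `τ` is fixed, whence the order of the choices.
    have e : D = (r : ℂ) • S * (T.op τ * R) - (r : ℂ) • (T.op τ * S - S) * R := by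
      rw [hD, hTS.eq, smul_sub, sub_mul, smul_mul_assoc, smul_mul_assoc, smul_mul_assoc, mul_assoc]
      abel
    have h1 : ‖(r : ℂ) • (T.op τ * S - S)‖ ≤
        M * ((Real.exp (r * τ) - 1) + r * (Real.exp (r * τ) * τ)) := by
      rw [norm_smul, Complex.norm_real, Real.norm_of_nonneg hr0.le]
      refine (mul_le_mul_of_nonneg_left (norm_op_mul_res_sub_le hM hr0 hτ0) hr0.le).trans_eq ?_
      field_simp
    calc ‖D‖ ≤ ‖(r : ℂ) • S‖ * ‖T.op τ * R‖ + ‖(r : ℂ) • (T.op τ * S - S)‖ * ‖R‖ := by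
          rw [e]
          exact (norm_sub_le _ _).trans (add_le_add (norm_mul_le _ _) (norm_mul_le _ _))
      _ ≤ M * ‖T.op τ * R‖ + M * ((Real.exp (r * τ) - 1) + r * (Real.exp (r * τ) * τ)) * ‖R‖ := by
          gcongr
      _ < 1 := by linarith
  set U : X →L[ℂ] X := ↑(Units.oneSub D hD1)⁻¹ with hU
  have hUD : U * (1 - D) = 1 := (Units.oneSub D hD1).inv_mul
  have hRD : Commute R D := by
    rw [hD, smul_mul_assoc]
    exact (hSR.symm.mul_right (Commute.refl R)).smul_right _
  have hRU : Commute (1 - R) U :=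
    Commute.units_inv_right (u := Units.oneSub D hD1)
      (((Commute.one_left _).sub_left ((Commute.one_right R).sub_right hRD)))
  have hSB : (S + 1) * (1 - R) = 1 - D := by
    have : S * (1 - R) = R - D := by
      ext x
      have := hSr.left_inv ⟨R x, hR1.mem_domain x⟩
      rw [hA] at this
      change S (x - R x) = R x - (r : ℂ) • S (R x)
      simp only [map_sub, map_smul] at this ⊢
      rw [eq_sub_iff_add_eq]
      nth_rw 3 [← this]
      abel
    rw [add_mul, this]
    simp
  have hinv : U * (S + 1) * (1 - R) = 1 := by rw [mul_assoc, hSB, hUD]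
  have hinv' : (1 - R) * (U * (S + 1)) = 1 := by
    have hSB' : Commute (1 - R) (S + 1) :=
      ((Commute.one_left _).sub_left hSR.symm).add_right (Commute.one_right _)
    rw [(hRU.mul_right hSB').eq, hinv]
  -- The inverse of `-A` is `R (1 - R)⁻¹`.
  refine ⟨R * (U * (S + 1)), fun x => hR1.mem_domain _, fun x => ?_, fun x => ?_⟩
  · have h2 : (1 - R) ((U * (S + 1)) x) = x := DFunLike.congr_fun hinv' x
    change (U * (S + 1)) x - R ((U * (S + 1)) x) = x at h2
    change (0 : ℂ) • _ - T.generator ⟨R ((U * (S + 1)) x), _⟩ = x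
    rw [zero_smul, zero_sub, hA, neg_sub, h2]
  · have h1 := hR1.left_inv x
    have h2 : (U * (S + 1)) ((1 - R) ((1 : ℂ) • (x : X) - T.generator x)) =
      (1 : ℂ) • (x : X) - T.generator x := DFunLike.congr_fun hinv _
    have h3 : (1 - R) ((1 : ℂ) • (x : X) - T.generator x) = -T.generator x := by
      change ((1 : ℂ) • (x : X) - T.generator x) - R _ = _
      rw [h1, one_smul]
      abel
    rw [h3] at h2
    change R ((U * (S + 1)) ((0 : ℂ) • (x : X) - T.generator x)) = x
    rw [zero_smul, zero_sub, h2, h1]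

variable {Q : X →L[ℂ] X} (hQ : IsResolvent T.generator 0 Q)
include hQ

omit hM [CompleteSpace X] in
theorem commute_inverse {B : X →L[ℂ] X} (hB : ∀ t, 0 ≤ t → Commute B (T.op t)) : Commute B Q :=
  hQ.commute_of_commutes (T.commutes_generator hB)

omit hM [CompleteSpace X] in
theorem op_commute_inverse {t : ℝ} (ht : 0 ≤ t) : Commute (T.op t) Q :=
  commute_inverse hQ fun _ hs => T.op_commute ht hs

theorem denseRange_inverse : DenseRange Q := by
  refine (dense_domain hM).mono fun x hx => ⟨-T.generator ⟨x, hx⟩, ?_⟩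
  exact (hQ.eq_zero_apply ⟨x, hx⟩).symm

theorem denseRange_inverse_pow (k : ℕ) : DenseRange (Q ^ k : X →L[ℂ] X) := by
  induction k with
  | zero => exact Function.surjective_id.denseRange
  | succ k ih =>
    rw [pow_succ]
    exact ih.comp (denseRange_inverse hM hQ) (Q ^ k).continuous

/-- Cancellation of a power of the inverse, which has dense range. -/
theorem eq_of_mul_inverse_pow {Y : Type*} [NormedAddCommGroup Y] [NormedSpace ℂ Y]
    {B D : X →L[ℂ] Y} {k : ℕ} (h : ∀ x, B ((Q ^ k) x) = D ((Q ^ k) x)) : B = D :=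
  DFunLike.coe_injective
    ((denseRange_inverse_pow hM hQ k).equalizer B.continuous D.continuous (funext h))

theorem inverse_eq : Q = res T.generator 1 * (1 + Q) := by
  have hR := isResolvent_res hM (z := 1) (by simp)
  ext x
  have := hR.left_inv ⟨Q x, hQ.mem_domain x⟩
  rw [hQ.apply_zero, one_smul, sub_neg_eq_add, add_comm] at this
  exact this.symm

/-- Orbits are only known to be strongly continuous; one factor `Q` yields norm continuity, so the
operator-valued integrals below have measurable integrands. -/
theorem continuousOn_op_mul_inverse : ContinuousOn (fun t => T.op t * Q) (Ici 0) := by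
  refine continuousOn_of_tendsto_zero (M := M) (fun s t hs hst => ?_) ?_
  · have : T.op t * Q - T.op s * Q = T.op s * (T.op (t - s) * Q - T.op 0 * Q) := by
      rw [T.op_zero, one_mul, mul_sub, ← mul_assoc, ← T.op_add s _ hs (sub_nonneg.2 hst)]
      simp
    rw [this]
    exact (norm_mul_le _ _).trans (mul_le_mul_of_nonneg_right (hM s hs) (norm_nonneg _))
  · rw [tendsto_iff_norm_sub_tendsto_zero]
    have hc : Continuous fun h : ℝ =>
        M * ((Real.exp (1 * h) - 1) / 1 + Real.exp (1 * h) * h) * ‖1 + Q‖ := by fun_prop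
    have h0 := (hc.tendsto 0).mono_left (nhdsWithin_le_nhds (s := Ioi 0))
    simp only [mul_zero, Real.exp_zero, sub_self, zero_div, add_zero, zero_mul] at h0
    refine squeeze_zero' (Eventually.of_forall fun _ => norm_nonneg _) ?_ h0
    filter_upwards [self_mem_nhdsWithin] with t ht
    have : T.op t * Q - T.op 0 * Q =
        (T.op t * res T.generator 1 - res T.generator 1) * (1 + Q) := by
      rw [T.op_zero, one_mul, sub_mul, mul_assoc, ← inverse_eq hM hQ]
    rw [this]
    refine (norm_mul_le _ _).trans (mul_le_mul_of_nonneg_right ?_ (norm_nonneg _))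
    simpa using norm_op_mul_res_sub_le hM one_pos (le_of_lt ht)

/-- For `t ≥ t₁` the rate transfers through `Q = R (1 + Q)` and `1 + t ≤ 2 t`; for `t ≤ t₁`
boundedness of the semigroup suffices. -/
theorem exists_norm_op_mul_inverse_le {δ : ℝ} (hδ : 0 < δ)
    (h : (fun t : ℝ => ‖T.op t ∘L res T.generator 1‖) =O[atTop] fun t : ℝ => t ^ (-δ)) :
    ∃ c : ℝ, 0 < c ∧ ∀ t, 0 ≤ t → ‖T.op t * Q‖ ≤ c * (1 + t) ^ (-δ) := by
  obtain ⟨c, hc, h⟩ := h.exists_pos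
  obtain ⟨t₀, ht₀⟩ := eventually_atTop.1 h.bound
  set t₁ := max t₀ 1 with ht₁
  have hM0 := bound_nonneg hM
  have h1 : (0 : ℝ) < 1 + t₁ := by have := le_max_right t₀ 1; linarith
  refine ⟨c * 2 ^ δ * ‖1 + Q‖ + M * ‖Q‖ * (1 + t₁) ^ δ + 1, by positivity, fun t ht => ?_⟩
  have ht' : 0 < (1 + t) := by linarith
  have hp : 0 < (1 + t) ^ (-δ) := Real.rpow_pos_of_pos ht' _
  rcases le_total t₁ t with htt | htt
  · have ha := ht₀ t ((le_max_left _ _).trans htt)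
    have hb : (1 : ℝ) ≤ t := (le_max_right _ _).trans htt
    rw [norm_norm, Real.norm_of_nonneg (by positivity)] at ha
    have h2 : t ^ (-δ) ≤ 2 ^ δ * (1 + t) ^ (-δ) := by
      have h3 : ((1 + t) / 2) ^ (-δ) = 2 ^ δ * (1 + t) ^ (-δ) := by
        rw [Real.div_rpow ht'.le zero_le_two, Real.rpow_neg zero_le_two δ]
        field_simp
      rw [← h3]
      exact Real.rpow_le_rpow_of_nonpos (by linarith) (by linarith) (by linarith)
    calc ‖T.op t * Q‖ = ‖T.op t ∘L res T.generator 1 * (1 + Q)‖ := by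
          nth_rw 1 [inverse_eq hM hQ, ← mul_assoc]; rfl
      _ ≤ ‖T.op t ∘L res T.generator 1‖ * ‖1 + Q‖ := norm_mul_le _ _
      _ ≤ c * (2 ^ δ * (1 + t) ^ (-δ)) * ‖1 + Q‖ := by
          gcongr
          exact ha.trans (mul_le_mul_of_nonneg_left h2 hc.le)
      _ = (c * 2 ^ δ * ‖1 + Q‖) * (1 + t) ^ (-δ) := by ring
      _ ≤ _ := by
          refine mul_le_mul_of_nonneg_right ?_ hp.le
          have : 0 ≤ M * ‖Q‖ * (1 + t₁) ^ δ := by positivity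
          linarith
  · have h2 : 1 ≤ (1 + t₁) ^ δ * (1 + t) ^ (-δ) := by
      rw [Real.rpow_neg ht'.le, ← div_eq_mul_inv, le_div_iff₀ (by positivity), one_mul]
      exact Real.rpow_le_rpow ht'.le (by linarith) hδ.le
    calc ‖T.op t * Q‖ ≤ M * ‖Q‖ :=
          (norm_mul_le _ _).trans (mul_le_mul_of_nonneg_right (hM t ht) (norm_nonneg _))
      _ ≤ M * ‖Q‖ * ((1 + t₁) ^ δ * (1 + t) ^ (-δ)) := le_mul_of_one_le_right (by positivity) h2
      _ = (M * ‖Q‖ * (1 + t₁) ^ δ) * (1 + t) ^ (-δ) := by ring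
      _ ≤ _ := by
          refine mul_le_mul_of_nonneg_right ?_ hp.le
          have : 0 ≤ c * 2 ^ δ * ‖1 + Q‖ := by positivity
          linarith

omit hM [CompleteSpace X] in
theorem op_nat_mul_mul_pow (k : ℕ) {t : ℝ} (ht : 0 ≤ t) :
    T.op (k * t) * Q ^ k = (T.op t * Q) ^ k := by
  induction k with
  | zero => simp [T.op_zero]
  | succ k ih =>
    have h1 : ((k + 1 : ℕ) : ℝ) * t = k * t + t := by push_cast; ring
    rw [h1, T.op_add _ _ (by positivity) ht, pow_succ (T.op t * Q), ← ih, pow_succ, mul_assoc,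
      mul_assoc, ← mul_assoc (T.op t), ((op_commute_inverse hQ ht).pow_right k).eq, mul_assoc]

omit hM [CompleteSpace X] in
-- Since `T(t) Q ^ k = (T(t / k) Q) ^ k`, the rate becomes `k δ`, which exceeds `2` for `k > 2 / δ`.
-- Rate `2` makes `t ^ (a - 1) T(t) Q ^ k` integrable for `0 < a ≤ 1`.
theorem exists_norm_op_mul_inverse_pow_le {c δ : ℝ} (hδ : 0 < δ)
    (h : ∀ t, 0 ≤ t → ‖T.op t * Q‖ ≤ c * (1 + t) ^ (-δ)) :
    ∃ (k : ℕ) (c' : ℝ), 0 < k ∧ 0 < c' ∧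
      ∀ t, 0 ≤ t → ‖T.op t * Q ^ k‖ ≤ c' * (1 + t) ^ (-2 : ℝ) := by
  obtain ⟨k, hk⟩ := exists_nat_gt (2 / δ)
  have hk0 : (0 : ℝ) < k := lt_trans (by positivity) hk
  have hk1 : 0 < k := by exact_mod_cast hk0
  have hk2 : 2 < k * δ := (div_lt_iff₀ hδ).1 hk
  have hk3 : (1 : ℝ) ≤ k := by exact_mod_cast hk1
  have hc : 0 ≤ c := by simpa using (norm_nonneg _).trans (h 0 le_rfl)
  refine ⟨k, c ^ k * (k : ℝ) ^ (2 : ℝ) + 1, hk1, by positivity, fun t ht => ?_⟩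
  have h1 : T.op t * Q ^ k = (T.op (t / k) * Q) ^ k := by
    rw [← op_nat_mul_mul_pow hQ k (by positivity)]
    congr 2
    field_simp
  have hb : (1 : ℝ) ≤ 1 + t / k := by have : 0 ≤ t / k := by positivity
                                      linarith
  have h2 : ((1 + t / k) ^ (-δ)) ^ k ≤ (k : ℝ) ^ (2 : ℝ) * (1 + t) ^ (-2 : ℝ) := by
    calc ((1 + t / k) ^ (-δ)) ^ k = (1 + t / k) ^ (-δ * k) := by
          rw [Real.rpow_mul (by positivity), Real.rpow_natCast]
      _ ≤ (1 + t / k) ^ (-2 : ℝ) := Real.rpow_le_rpow_of_exponent_le hb (by linarith)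
      _ ≤ ((1 + t) / k) ^ (-2 : ℝ) := by
          refine Real.rpow_le_rpow_of_nonpos (by positivity) ?_ (by norm_num)
          rw [add_div]
          gcongr
          exact (div_le_one hk0).2 hk3
      _ = (k : ℝ) ^ (2 : ℝ) * (1 + t) ^ (-2 : ℝ) := by
          rw [Real.div_rpow (by positivity) hk0.le, Real.rpow_neg hk0.le]
          field_simp
  calc ‖T.op t * Q ^ k‖ ≤ ‖T.op (t / k) * Q‖ ^ k := by
        rw [h1]; exact norm_pow_le' _ hk1
    _ ≤ (c * (1 + t / k) ^ (-δ)) ^ k := by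
        gcongr
        exact h _ (by positivity)
    _ ≤ c ^ k * ((k : ℝ) ^ (2 : ℝ) * (1 + t) ^ (-2 : ℝ)) := by
        rw [mul_pow]
        gcongr
    _ ≤ _ := by
        have : (0 : ℝ) < (1 + t) ^ (-2 : ℝ) := by positivity
        nlinarith

end Semigroup

end Stability

/-! ### Plancherel's theorem for Hilbert-space valued functions -/

section Plancherel

open FourierTransform SchwartzMap
open scoped ContDiff

variable {F : Type*} [NormedAddCommGroup F] [InnerProductSpace ℂ F] [CompleteSpace F]

/-- Both transforms have the same pairing with every smooth compactly supported function: the `L²`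
one through tempered distributions, the integral one through Fubini's theorem. -/
theorem fourier_toLp_ae_eq {f : ℝ → F} (h1 : Integrable f) (h2 : MemLp f 2) :
    (𝓕 (h2.toLp f) : Lp (α := ℝ) F 2) =ᵐ[volume] 𝓕 f := by
  have hcont : Continuous (𝓕 f) :=
    VectorFourier.fourierIntegral_continuous Real.continuous_fourierChar
      (by exact continuous_inner) h1
  refine ae_eq_of_integral_contDiff_smul_eq ((Lp.memLp _).locallyIntegrable (by norm_num))
    hcont.locallyIntegrable fun g hg hgc => ?_
  have hg₁ : HasCompactSupport (Complex.ofRealCLM ∘ g) := hgc.comp_left rfl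
  have hg₂ : ContDiff ℝ ∞ (Complex.ofRealCLM ∘ g) := Complex.ofRealCLM.contDiff.comp hg
  set G : 𝓢(ℝ, ℂ) := hg₁.toSchwartzMap hg₂ with hG
  have hGg : ∀ x, G x = (g x : ℂ) := fun x => rfl
  have e := congrArg (fun u => u G) (Lp.fourier_toTemperedDistribution_eq (h2.toLp f))
  simp only [TemperedDistribution.fourier_apply, Lp.toTemperedDistribution_apply] at e
  have e2 : ∫ x, (𝓕 G : 𝓢(ℝ, ℂ)) x • (h2.toLp f) x = ∫ x, G x • 𝓕 f x := by
    have e3 := VectorFourier.integral_fourierIntegral_smul_eq_flip (L := innerₗ ℝ)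
      (μ := volume) (ν := volume) Real.continuous_fourierChar
      (by exact continuous_inner) G.integrable h1
    rw [flip_innerₗ] at e3
    rw [← show _ = ∫ x, G x • 𝓕 f x from e3]
    refine integral_congr_ae ?_
    filter_upwards [h2.coeFn_toLp] with x hx
    rw [hx]
    rfl
  rw [e2] at e
  simp only [hGg, Complex.coe_smul] at e
  exact e.symm

/-- Plancherel's theorem for integrable square integrable functions. -/
theorem eLpNorm_fourier_eq {f : ℝ → F} (h1 : Integrable f) (h2 : MemLp f 2) :
    eLpNorm (𝓕 f) 2 volume = eLpNorm f 2 volume := by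
  rw [← eLpNorm_congr_ae (fourier_toLp_ae_eq h1 h2), ← eLpNorm_congr_ae h2.coeFn_toLp]
  have h := Lp.norm_fourier_eq (h2.toLp f)
  rw [Lp.norm_def, Lp.norm_def] at h
  exact (ENNReal.toReal_eq_toReal_iff' (Lp.eLpNorm_ne_top _) (Lp.eLpNorm_ne_top _)).1 h

theorem integral_norm_sq_le_of_norm_fourier_le {f g : ℝ → F} (hf : Integrable f)
    (hf2 : MemLp f 2) (hg : Integrable g) (hg2 : MemLp g 2) {c : ℝ} (hc : 0 ≤ c)
    (h : ∀ ξ, ‖𝓕 g ξ‖ ≤ c * ‖𝓕 f ξ‖) : ∫ s, ‖g s‖ ^ 2 ≤ c ^ 2 * ∫ s, ‖f s‖ ^ 2 := by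
  have h1 := eLpNorm_le_mul_eLpNorm_of_ae_le_mul (μ := volume) (Eventually.of_forall h) 2
  rw [eLpNorm_fourier_eq hf hf2, eLpNorm_fourier_eq hg hg2,
    hf2.eLpNorm_eq_integral_rpow_norm two_ne_zero ENNReal.ofNat_ne_top,
    hg2.eLpNorm_eq_integral_rpow_norm two_ne_zero ENNReal.ofNat_ne_top,
    ← ENNReal.ofReal_mul hc, ENNReal.ofReal_le_ofReal_iff (by positivity)] at h1
  simp only [ENNReal.toReal_ofNat, Real.rpow_ofNat] at h1
  have hF : 0 ≤ ∫ s, ‖f s‖ ^ 2 := integral_nonneg fun s => by positivity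
  have hG : 0 ≤ ∫ s, ‖g s‖ ^ 2 := integral_nonneg fun s => by positivity
  have h2 := pow_le_pow_left₀ (by positivity) h1 2
  rw [mul_pow, ← Real.rpow_natCast, ← Real.rpow_mul hG, ← Real.rpow_natCast (_ ^ (2 : ℝ)⁻¹),
    ← Real.rpow_mul hF] at h2
  norm_num at h2
  exact h2

end Plancherel

namespace Semigroup

/-! ### Convolution and Laplace transforms of `t ^ m T(t)` -/

section Moments

variable {X : Type*} [NormedAddCommGroup X] [NormedSpace ℂ X] [CompleteSpace X]
variable {T : Semigroup X} {M : ℝ} (hM : ∀ t, 0 ≤ t → ‖T.op t‖ ≤ M)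
variable {Q : X →L[ℂ] X} (hQ : IsResolvent T.generator 0 Q)
include hM hQ

theorem continuousOn_op_mul_inverse_pow {k : ℕ} (hk : 0 < k) :
    ContinuousOn (fun t => T.op t * Q ^ k) (Ici 0) := by
  obtain ⟨k, rfl⟩ := Nat.exists_eq_add_of_lt hk
  have : ∀ t, T.op t * Q ^ (0 + k + 1) = T.op t * Q * Q ^ k := fun t => by
    rw [zero_add, pow_succ', mul_assoc]
  simp only [this]
  exact (continuousOn_op_mul_inverse hM hQ).mul continuousOn_const

theorem aestronglyMeasurable_op_mul_inverse_pow {k : ℕ} (hk : 0 < k) :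
    AEStronglyMeasurable (fun t => T.op t * Q ^ k) (volume.restrict (Ioi 0)) :=
  ((continuousOn_op_mul_inverse_pow hM hQ hk).mono
    Ioi_subset_Ici_self).aestronglyMeasurable measurableSet_Ioi

theorem integrableOn_smul_op_mul_inverse_pow {k : ℕ} (hk : 0 < k) {φ : ℝ → ℂ}
    (hφ : IntegrableOn φ (Ioi 0)) : IntegrableOn (fun t => φ t • (T.op t * Q ^ k)) (Ioi 0) := by
  refine Integrable.mono' (hφ.norm.mul_const (M * ‖Q ^ k‖))
    (hφ.aestronglyMeasurable.smul (aestronglyMeasurable_op_mul_inverse_pow hM hQ hk)) ?_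
  filter_upwards [ae_restrict_mem measurableSet_Ioi] with t ht
  rw [norm_smul]
  exact mul_le_mul_of_nonneg_left ((norm_mul_le _ _).trans
    (mul_le_mul_of_nonneg_right (hM t (le_of_lt ht)) (norm_nonneg _))) (norm_nonneg _)

omit hM in
/-- Products of weighted averages of the semigroup are averages for the convolved weight. -/
theorem integral_op_mul_integral_op {k : ℕ} {φ ψ : ℝ → ℂ}
    (hφ : IntegrableOn (fun t => φ t • (T.op t * Q ^ k)) (Ioi 0))
    (hψ : IntegrableOn (fun t => ψ t • (T.op t * Q ^ k)) (Ioi 0)) :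
    (∫ t in Ioi (0 : ℝ), φ t • (T.op t * Q ^ k)) * (∫ t in Ioi (0 : ℝ), ψ t • (T.op t * Q ^ k)) =
      ∫ u in Ioi (0 : ℝ), (∫ t in (0 : ℝ)..u, φ t * ψ (u - t)) • (T.op u * Q ^ (k + k)) := by
  have h := integral_posConvolution hφ hψ (ContinuousLinearMap.mul ℝ (X →L[ℂ] X))
  simp only [ContinuousLinearMap.mul_apply'] at h
  rw [← h]
  refine setIntegral_congr_fun measurableSet_Ioi fun u hu => ?_
  have hu' : (0 : ℝ) < u := hu
  refine Eq.trans ?_ (intervalIntegral.integral_smul_const (𝕜 := ℂ) (E := X →L[ℂ] X) (μ := volume)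
    (a := 0) (b := u) (fun t => φ t * ψ (u - t)) (T.op u * Q ^ (k + k)))
  refine intervalIntegral.integral_congr_ae (Eventually.of_forall fun t ht => ?_)
  rw [uIoc_of_le hu'.le] at ht
  have h1 : T.op t * Q ^ k * (T.op (u - t) * Q ^ k) = T.op u * Q ^ (k + k) := by
    rw [mul_assoc, ← mul_assoc (Q ^ k),
      (((op_commute_inverse hQ (sub_nonneg.2 ht.2)).pow_right k).symm).eq, mul_assoc, ← pow_add,
      ← mul_assoc, ← T.op_add _ _ ht.1.le (sub_nonneg.2 ht.2), add_sub_cancel]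
  rw [smul_mul_smul_comm, h1]

omit hM hQ [CompleteSpace X] T in
theorem integrableOn_pow_mul_cexp {z : ℂ} (hz : 0 < z.re) (m : ℕ) :
    IntegrableOn (fun t : ℝ => (t : ℂ) ^ m * Complex.exp (-z * t)) (Ioi 0) := by
  have h := integrableOn_rpow_mul_exp_neg_mul_rpow (s := m) (p := 1) (b := z.re)
    (by have : (0 : ℝ) ≤ m := Nat.cast_nonneg m
        linarith) one_pos hz
  refine h.mono' (Continuous.aestronglyMeasurable (by fun_prop)) ?_
  filter_upwards [ae_restrict_mem measurableSet_Ioi] with t ht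
  have ht' : (0 : ℝ) < t := ht
  rw [norm_mul, norm_pow, Complex.norm_real, Real.norm_of_nonneg ht'.le, Complex.norm_exp]
  simp

/-- The Laplace transform of `t ^ m T(t)` is `m ! R(z, A) ^ (m + 1)`. -/
theorem integral_pow_mul_cexp_smul_op {z : ℂ} (hz : 0 < z.re) (m : ℕ) (x : X) :
    ∫ t in Ioi (0 : ℝ), ((t : ℂ) ^ m * Complex.exp (-z * t)) • T.op t x =
      (m.factorial : ℂ) • (res T.generator z ^ (m + 1)) x := by
  induction m generalizing x with
  | zero => simp [res_apply hM hz x]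
  | succ m ih =>
    have key : ∀ n w, (∀ y, ∫ t in Ioi (0 : ℝ), ((t : ℂ) ^ n * Complex.exp (-z * t)) • T.op t y =
      (n.factorial : ℂ) • (res T.generator z ^ (n + 1)) y) →
        (∫ t in Ioi (0 : ℝ), ((t : ℂ) ^ n * Complex.exp (-z * t)) • (T.op t * Q ^ 1)) w =
        (n.factorial : ℂ) • (res T.generator z ^ (n + 1)) (Q w) := by
      intro n w hn
      rw [ContinuousLinearMap.integral_apply (integrableOn_smul_op_mul_inverse_pow hM hQ one_pos
        (integrableOn_pow_mul_cexp hz n)), ← hn]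
      simp
    have hconv := integral_op_mul_integral_op hQ (k := 1)
      (integrableOn_smul_op_mul_inverse_pow hM hQ one_pos (integrableOn_pow_mul_cexp hz 0))
      (integrableOn_smul_op_mul_inverse_pow hM hQ one_pos (integrableOn_pow_mul_cexp hz m))
    -- Convolving the weights `e ^ (-z t)` and `t ^ m e ^ (-z t)` gives `u ^ (m + 1) e ^ (-z u) / (m
    -- + 1)`, which drives the induction.
    have hin : ∀ u : ℝ, (∫ t in (0 : ℝ)..u, ((t : ℂ) ^ 0 * Complex.exp (-z * t)) *
        (((u - t : ℝ) : ℂ) ^ m * Complex.exp (-z * (u - t : ℝ)))) =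
        ((m : ℂ) + 1)⁻¹ * ((u : ℂ) ^ (m + 1) * Complex.exp (-z * u)) := by
      intro u
      have h1 : ∀ t : ℝ, ((t : ℂ) ^ 0 * Complex.exp (-z * t)) *
          (((u - t : ℝ) : ℂ) ^ m * Complex.exp (-z * (u - t : ℝ))) =
          Complex.exp (-z * u) * (((u - t) ^ m : ℝ) : ℂ) := by
        intro t
        rw [pow_zero, one_mul, mul_left_comm, ← Complex.exp_add, mul_comm]
        push_cast
        congr 2
        ring
      simp only [h1]
      rw [intervalIntegral.integral_const_mul, intervalIntegral.integral_ofReal,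
        intervalIntegral.integral_comp_sub_left (fun x => x ^ m) u, integral_pow]
      push_cast
      simp
      ring
    obtain ⟨S, hS, -⟩ := exists_integral_op hM (integrableOn_pow_mul_cexp hz (m + 1))
    have hSeq : S = (((m + 1).factorial : ℕ) : ℂ) • res T.generator z ^ (m + 1 + 1) := by
      -- Each convolved operator integral carries one factor `Q`, so the identity is obtained on the
      -- range of `Q ^ 2`.
      refine eq_of_mul_inverse_pow hM hQ (k := 2) fun w => ?_
      have e := congrArg (fun B : X →L[ℂ] X => B w) hconv
      simp only [mul_apply_eq_comp] at e
      rw [key 0 _ (fun y => by simp [res_apply hM hz y]), key m w ih] at e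
      simp only [hin] at e
      have e2 : ∀ u : ℝ, (((m : ℂ) + 1)⁻¹ * ((u : ℂ) ^ (m + 1) * Complex.exp (-z * u))) •
          (T.op u * Q ^ (1 + 1)) = ((m : ℂ) + 1)⁻¹ • (((u : ℂ) ^ (m + 1) * Complex.exp (-z * u)) •
          (T.op u * Q ^ (1 + 1))) := fun u => by rw [mul_smul]
      simp only [e2] at e
      rw [integral_smul, smul_apply, ContinuousLinearMap.integral_apply
        (integrableOn_smul_op_mul_inverse_pow hM hQ (k := 1 + 1) (by norm_num)
          (integrableOn_pow_mul_cexp hz (m + 1)))] at e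
      have e3 : S ((Q ^ 2) w) = ∫ t in Ioi (0 : ℝ), (((t : ℂ) ^ (m + 1) * Complex.exp (-z * t)) •
          (T.op t * Q ^ (1 + 1))) w := hS _
      rw [← e3] at e
      have hm : (m : ℂ) + 1 ≠ 0 := Nat.cast_add_one_ne_zero m
      rw [eq_inv_smul_iff₀ hm] at e
      rw [← e]
      have hRQ : Commute Q (res T.generator z) :=
        commute_res hM hz fun t ht => (op_commute_inverse hQ ht).symm
      have e4 : Q ((res T.generator z ^ (m + 1)) (Q w)) =
          (res T.generator z ^ (m + 1)) ((Q ^ 2) w) := by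
        have := DFunLike.congr_fun (hRQ.pow_right (m + 1)).eq (Q w)
        simpa [pow_two] using this
      simp only [Nat.factorial_zero, Nat.cast_one, one_smul, zero_add, pow_one, map_smul, e4]
      rw [smul_smul, Nat.factorial_succ, smul_apply, pow_succ' _ (m + 1)]
      push_cast
      rfl
    rw [← hS, hSeq]
    rfl

end Moments

/-! ### The `L²` estimate from the Weiss condition -/

section Hilbert

open FourierTransform

variable {X : Type*} [NormedAddCommGroup X] [InnerProductSpace ℂ X] [CompleteSpace X]

omit [CompleteSpace X] in
theorem integrable_indicator_weight {T : Semigroup X} {M : ℝ}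
    (hM : ∀ t, 0 ≤ t → ‖T.op t‖ ≤ M) {a : ℝ} (ha : 0 < a) (m : ℕ) (B : X →L[ℂ] X) (x : X) :
    Integrable ((Ioi (0 : ℝ)).indicator
        fun s => ((s : ℂ) ^ m * Complex.exp (-a * s)) • B (T.op s x)) ∧
      MemLp ((Ioi (0 : ℝ)).indicator
        fun s => ((s : ℂ) ^ m * Complex.exp (-a * s)) • B (T.op s x)) 2 := by
  have ha' : 0 < (a : ℂ).re := by simpa using ha
  have h1 : IntegrableOn (fun s : ℝ => ((s : ℂ) ^ m * Complex.exp (-a * s)) • B (T.op s x))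
      (Ioi 0) := by
    simpa [IntegrableOn] using B.integrable_comp
      (integrableOn_smul_op_apply hM (integrableOn_pow_mul_cexp ha' m) x)
  have h1' := (integrable_indicator_iff measurableSet_Ioi).2 h1
  refine ⟨h1', (memLp_two_iff_integrable_sq_norm h1'.aestronglyMeasurable).2 ?_⟩
  have h2 : (fun s => ‖(Ioi (0 : ℝ)).indicator
      (fun s => ((s : ℂ) ^ m * Complex.exp (-a * s)) • B (T.op s x)) s‖ ^ 2) =
      (Ioi (0 : ℝ)).indicator
        fun s => ‖((s : ℂ) ^ m * Complex.exp (-a * s)) • B (T.op s x)‖ ^ 2 := by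
    funext s
    by_cases hs : s ∈ Ioi (0 : ℝ) <;> simp [hs]
  rw [h2, integrable_indicator_iff measurableSet_Ioi]
  have h3 := integrableOn_pow_mul_cexp (z := (2 * a : ℝ))
    (by simpa using ha) (2 * m)
  refine Integrable.mono' (h3.norm.mul_const ((‖B‖ * (M * ‖x‖)) ^ 2))
    (h1.aestronglyMeasurable.norm.pow 2) ?_
  filter_upwards [ae_restrict_mem measurableSet_Ioi] with s hs
  have hw : ‖(s : ℂ) ^ (2 * m) * Complex.exp (-((2 * a : ℝ) : ℂ) * s)‖ =
      ‖(s : ℂ) ^ m * Complex.exp (-a * s)‖ ^ 2 := by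
    rw [← norm_pow, mul_pow, ← pow_mul, ← Complex.exp_nat_mul, mul_comm m 2]
    congr 3
    push_cast
    ring
  rw [norm_pow, norm_norm, norm_smul, mul_pow, hw]
  gcongr
  exact B.le_opNorm_of_le (norm_op_apply_le hM (le_of_lt hs) x)

/-- With the damping `e ^ (-a s)`, the Fourier transform at `ξ` is the Laplace transform at `z = a +
2 π i ξ`, on the line `Re z = a`. -/
theorem fourier_indicator_weight {T : Semigroup X} {M : ℝ}
    (hM : ∀ t, 0 ≤ t → ‖T.op t‖ ≤ M) {a : ℝ} (ha : 0 < a) (m : ℕ) (B : X →L[ℂ] X) (x : X)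
    (ξ : ℝ) : 𝓕 ((Ioi (0 : ℝ)).indicator
        fun s => ((s : ℂ) ^ m * Complex.exp (-a * s)) • B (T.op s x)) ξ =
      B (∫ s in Ioi (0 : ℝ), ((s : ℂ) ^ m *
        Complex.exp (-(a + (2 * Real.pi * ξ : ℝ) * Complex.I) * s)) • T.op s x) := by
  have hz : 0 < ((a : ℂ) + (2 * Real.pi * ξ : ℝ) * Complex.I).re := by simpa using ha
  rw [← B.integral_comp_comm (integrableOn_smul_op_apply hM (integrableOn_pow_mul_cexp hz m) x),
    Real.fourier_real_eq_integral_exp_smul, ← integral_indicator measurableSet_Ioi]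
  congr 1
  funext s
  by_cases hs : s ∈ Ioi (0 : ℝ)
  · simp only [indicator_of_mem hs]
    rw [smul_smul, map_smul, mul_left_comm, ← Complex.exp_add]
    congr 3
    push_cast
    ring
  · simp only [indicator_of_notMem hs, smul_zero]

omit [CompleteSpace X] in
theorem integral_norm_sq_weight_le {T : Semigroup X} {M : ℝ} (hM : ∀ t, 0 ≤ t → ‖T.op t‖ ≤ M)
    {a : ℝ} (ha : 0 < a) (x : X) :
    ∫ s, ‖(Ioi (0 : ℝ)).indicator
      (fun s => ((s : ℂ) ^ 0 * Complex.exp (-a * s)) • (1 : X →L[ℂ] X) (T.op s x)) s‖ ^ 2 ≤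
        (M * ‖x‖) ^ 2 / (2 * a) := by
  have hM0 := bound_nonneg hM
  have h := integral_exp_mul_Ioi (a := -(2 * a)) (by linarith) 0
  have hi := (integrableOn_exp_mul_Ioi (a := -(2 * a)) (by linarith) 0).const_mul ((M * ‖x‖) ^ 2)
  have h2 : (M * ‖x‖) ^ 2 / (2 * a) =
      ∫ s in Ioi (0 : ℝ), (M * ‖x‖) ^ 2 * Real.exp (-(2 * a) * s) := by
    rw [integral_const_mul, h, mul_zero, Real.exp_zero]
    field_simp
  rw [h2, ← integral_indicator measurableSet_Ioi]
  refine integral_mono_of_nonneg (Eventually.of_forall fun s => by positivity)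
    ((integrable_indicator_iff measurableSet_Ioi).2 hi) (Eventually.of_forall fun s => ?_)
  by_cases hs : s ∈ Ioi (0 : ℝ)
  · simp only [indicator_of_mem hs, pow_zero, one_mul, one_apply_eq_self]
    rw [norm_smul, mul_pow, mul_comm]
    have e : ‖Complex.exp (-a * s)‖ ^ 2 = Real.exp (-(2 * a) * s) := by
      rw [Complex.norm_exp, ← Real.exp_nat_mul]
      simp
      ring
    rw [e]
    gcongr
    exact norm_op_apply_le hM (le_of_lt hs) x
  · simp [indicator_of_notMem hs]

/-- On a Hilbert space, the `2`-Weiss condition for an operator `E` commuting with the semigroup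
gives `‖E T(t)‖ = O(t ^ (-1 / 2))`. Here `E` is represented by the bounded operator
`W = E (-A)⁻¹`. -/
theorem norm_apply_op_le_of_weiss {T : Semigroup X} {M : ℝ} (hM : ∀ t, 0 ≤ t → ‖T.op t‖ ≤ M)
    {Q : X →L[ℂ] X} (hQ : IsResolvent T.generator 0 Q) {W : X →L[ℂ] X}
    (hW : ∀ t, 0 ≤ t → Commute W (T.op t)) {K : ℝ} (hK : 0 < K)
    (hWK : ∀ z : ℂ, 0 < z.re → ∀ x,
      ‖W ((1 - z • res T.generator z) x)‖ ≤ K / z.re ^ (1 / 2 : ℝ) * ‖x‖)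
    {t : ℝ} (ht : 0 < t) (x : X) :
    ‖W (T.op t x)‖ ≤ 4 * M ^ 2 * K * t ^ (-(1 / 2) : ℝ) * ‖Q x‖ := by
  have hM0 := bound_nonneg hM
  -- With `a = 1 / t` the damping stays above `e⁻¹` on `[0, t]`.
  set a := t⁻¹ with ha_def
  have ha : 0 < a := inv_pos.2 ht
  -- The two functions are `e ^ (-a s) T(s) Q x` and `s e ^ (-a s) W T(s) x`. Their Fourier
  -- transforms are `R Q x` and `W R ^ 2 x = W (1 - z R) R Q x`, so the Weiss bound compares them
  -- pointwise.
  have hf := integrable_indicator_weight hM ha 0 1 (Q x)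
  have hg := integrable_indicator_weight hM ha 1 W x
  have hint := integral_norm_sq_le_of_norm_fourier_le hf.1 hf.2 hg.1 hg.2
    (c := K / a ^ (1 / 2 : ℝ)) (by positivity) (fun ξ => by
      rw [fourier_indicator_weight hM ha, fourier_indicator_weight hM ha]
      have hz : 0 < ((a : ℂ) + (2 * Real.pi * ξ : ℝ) * Complex.I).re := by simpa using ha
      rw [integral_pow_mul_cexp_smul_op hM hQ hz, integral_pow_mul_cexp_smul_op hM hQ hz]
      set z := (a : ℂ) + (2 * Real.pi * ξ : ℝ) * Complex.I with hz_def
      have hza : z.re = a := by simp [hz_def]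
      have h1 := hWK z hz (res T.generator z (Q x))
      rw [hza] at h1
      have h2 : (res T.generator z ^ (1 + 1)) x =
          (1 - z • res T.generator z) (res T.generator z (Q x)) := by
        have hQR : Commute Q (res T.generator z) :=
          commute_res hM hz fun t ht => (op_commute_inverse hQ ht).symm
        have e1 := hQ.one_sub_smul_mul (isResolvent_res hM hz)
        have e2 : (1 - z • res T.generator z) * (res T.generator z * Q) =
            res T.generator z ^ (1 + 1) := by
          rw [← hQR.eq, ← mul_assoc, e1, pow_two]
        rw [← e2]
        rfl
      simpa [h2] using h1)
  -- For `s ≤ t`, `W T(t) x = T(t - s) W T(s) x` has norm at most `M ‖W T(s) x‖`. Integrating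
  -- against `s ^ 2` gives `t ^ 3 / 3`, and `8 ≥ e ^ 2` pays for the squared damping.
  have hlow : ‖W (T.op t x)‖ ^ 2 * (t ^ 3 / 3) ≤ (M ^ 2 * 8) * ∫ s, ‖(Ioi (0 : ℝ)).indicator
      (fun s => ((s : ℂ) ^ 1 * Complex.exp (-a * s)) • W (T.op s x)) s‖ ^ 2 := by
    have hg2 := ((memLp_two_iff_integrable_sq_norm hg.1.aestronglyMeasurable).1 hg.2).const_mul
      (M ^ 2 * 8)
    have e : ‖W (T.op t x)‖ ^ 2 * (t ^ 3 / 3) =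
        ∫ s in Ioc (0 : ℝ) t, ‖W (T.op t x)‖ ^ 2 * s ^ 2 := by
      rw [integral_const_mul, ← intervalIntegral.integral_of_le ht.le, integral_pow]
      norm_num
    rw [e, ← integral_const_mul, ← integral_indicator measurableSet_Ioc]
    refine integral_mono_of_nonneg (Eventually.of_forall fun s => ?_) hg2
      (Eventually.of_forall fun s => ?_)
    · exact indicator_nonneg (fun s _ => by positivity) s
    · by_cases hs : s ∈ Ioc (0 : ℝ) t
      · have hs0 : s ∈ Ioi (0 : ℝ) := hs.1
        simp only [indicator_of_mem hs, indicator_of_mem hs0, pow_one]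
        have h1 : W (T.op t x) = T.op (t - s) (W (T.op s x)) := by
          have h2 : W (T.op (t - s) (T.op s x)) = T.op (t - s) (W (T.op s x)) :=
            DFunLike.congr_fun (hW (t - s) (sub_nonneg.2 hs.2)).eq (T.op s x)
          rw [← h2, ← T.op_add_apply (sub_nonneg.2 hs.2) hs.1.le, sub_add_cancel]
        have h3 : ‖W (T.op t x)‖ ≤ M * ‖W (T.op s x)‖ := by
          rw [h1]
          exact norm_op_apply_le hM (sub_nonneg.2 hs.2) _
        have h4 : 1 ≤ 8 * ‖Complex.exp (-a * s)‖ ^ 2 := by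
          rw [Complex.norm_exp, ← Real.exp_nat_mul]
          have h5 : -2 ≤ ((2 : ℕ) : ℝ) * (-(a : ℂ) * s).re := by
            have : a * s ≤ 1 := by
              rw [ha_def, inv_mul_le_iff₀ ht, mul_one]
              exact hs.2
            simp
            linarith
          have h6 := Real.exp_le_exp.2 h5
          have h7 : Real.exp (-2) * 8 ≥ 1 := by
            have e1 := Real.exp_one_lt_d9
            have e2 : Real.exp 2 = Real.exp 1 ^ 2 := by rw [← Real.exp_nat_mul]; norm_num
            have e3 : Real.exp 2 ≤ 8 := by
              rw [e2]
              nlinarith [Real.exp_pos 1]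
            rw [Real.exp_neg, ge_iff_le, inv_mul_eq_div, le_div_iff₀ (Real.exp_pos 2), one_mul]
            exact e3
          linarith
        rw [norm_smul, norm_mul, Complex.norm_real, Real.norm_of_nonneg hs.1.le]
        calc ‖W (T.op t x)‖ ^ 2 * s ^ 2 ≤ (M * ‖W (T.op s x)‖) ^ 2 * s ^ 2 * 1 := by
              rw [mul_one]; gcongr
          _ ≤ (M * ‖W (T.op s x)‖) ^ 2 * s ^ 2 * (8 * ‖Complex.exp (-a * s)‖ ^ 2) := by gcongr
          _ = _ := by ring
      · simp only [indicator_of_notMem hs]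
        positivity
  have hup := integral_norm_sq_weight_le hM ha (Q x)
  have hc : (K / a ^ (1 / 2 : ℝ)) ^ 2 = K ^ 2 * t := by
    rw [div_pow, ← Real.rpow_natCast, ← Real.rpow_natCast (a ^ _), ← Real.rpow_mul ha.le, ha_def]
    norm_num
  rw [hc] at hint
  have hsq : ‖W (T.op t x)‖ ^ 2 ≤ (4 * M ^ 2 * K * t ^ (-(1 / 2) : ℝ) * ‖Q x‖) ^ 2 := by
    have e1 : (t ^ (-(1 / 2) : ℝ)) ^ 2 = t⁻¹ := by
      rw [← Real.rpow_natCast, ← Real.rpow_mul ht.le]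
      norm_num [Real.rpow_neg_one]
    have h1 : ‖W (T.op t x)‖ ^ 2 * (t ^ 3 / 3) ≤
        M ^ 2 * 8 * (K ^ 2 * t * ((M * ‖Q x‖) ^ 2 / (2 * a))) := by
      refine hlow.trans (mul_le_mul_of_nonneg_left (hint.trans ?_) (by positivity))
      exact mul_le_mul_of_nonneg_left hup (by positivity)
    -- Here `12 = 8 · 3 / 2`; below it is raised to `16 = 4 ^ 2` to get the constant `4`.
    have h2 : M ^ 2 * 8 * (K ^ 2 * t * ((M * ‖Q x‖) ^ 2 / (2 * a))) =
        (12 * M ^ 4 * K ^ 2 * ‖Q x‖ ^ 2 * t⁻¹) * (t ^ 3 / 3) := by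
      rw [ha_def]
      field_simp
      ring
    rw [h2] at h1
    have h3 := le_of_mul_le_mul_right h1 (by positivity)
    have h4 : 0 ≤ M ^ 4 * K ^ 2 * ‖Q x‖ ^ 2 * t⁻¹ := by positivity
    calc _ ≤ _ := h3
      _ ≤ 16 * (M ^ 4 * K ^ 2 * ‖Q x‖ ^ 2 * t⁻¹) := by linarith
      _ = _ := by rw [mul_pow, mul_pow _ (t ^ _), e1]; ring
  exact le_of_sq_le_sq hsq (by positivity)

end Hilbert

end Semigroup

/-! ### Negative fractional powers as integrals of the semigroup and the resolvent -/

section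

variable {X : Type*} [NormedAddCommGroup X] [NormedSpace ℂ X]

/-- The resolvent identity. -/
theorem IsResolvent.sub_eq {A : X →ₗ.[ℂ] X} {z w : ℂ} {R S : X →L[ℂ] X} (hR : IsResolvent A z R)
    (hS : IsResolvent A w S) : R - S = (w - z) • (R * S) := by
  ext x
  have h1 := hS.right_inv x
  have h2 := hR.left_inv ⟨S x, hS.mem_domain x⟩
  change R x - S x = (w - z) • R (S x)
  change R (z • S x - _) = S x at h2
  have h3 := congrArg R (h1.symm.trans (show _ = (w - z) • S x + (z • S x - _) by
    rw [sub_smul, sub_add_sub_cancel]))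
  rw [map_add, map_smul, h2] at h3
  rw [h3, add_sub_cancel_right]

end

theorem integrableOn_rpow_mul_one_add_rpow {a : ℝ} (ha : 0 < a) (ha1 : a ≤ 1) :
    IntegrableOn (fun t : ℝ => t ^ (a - 1) * (1 + t) ^ (-2 : ℝ)) (Ioi 0) := by
  have hm : Measurable fun t : ℝ => t ^ (a - 1) * (1 + t) ^ (-2 : ℝ) := by fun_prop
  rw [← Ioc_union_Ioi_eq_Ioi zero_le_one]
  refine IntegrableOn.union ?_ ?_
  · have h : IntegrableOn (fun t : ℝ => t ^ (a - 1)) (Ioc 0 1) := by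
      rw [← intervalIntegrable_iff_integrableOn_Ioc_of_le zero_le_one]
      exact intervalIntegral.intervalIntegrable_rpow' (by linarith)
    refine Integrable.mono' h hm.aestronglyMeasurable ?_
    filter_upwards [ae_restrict_mem measurableSet_Ioc] with t ht
    have h0 : 0 < t ^ (a - 1) := Real.rpow_pos_of_pos ht.1 _
    have h1 : 0 < (1 + t) ^ (-2 : ℝ) := Real.rpow_pos_of_pos (by linarith [ht.1]) _
    rw [Real.norm_of_nonneg (by positivity)]
    exact mul_le_of_le_one_right h0.le
      (Real.rpow_le_one_of_one_le_of_nonpos (by linarith [ht.1]) (by norm_num))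
  · refine Integrable.mono' (integrableOn_Ioi_rpow_of_lt (a := -2) (by norm_num) zero_lt_one)
      hm.aestronglyMeasurable ?_
    filter_upwards [ae_restrict_mem measurableSet_Ioi] with t ht
    have ht1 : (1 : ℝ) < t := ht
    have h0 : 0 < t ^ (a - 1) := Real.rpow_pos_of_pos (by linarith) _
    have h1 : 0 < (1 + t) ^ (-2 : ℝ) := Real.rpow_pos_of_pos (by linarith) _
    rw [Real.norm_of_nonneg (by positivity)]
    refine (mul_le_of_le_one_left h1.le
      (Real.rpow_le_one_of_one_le_of_nonpos ht1.le (by linarith))).trans ?_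
    exact Real.rpow_le_rpow_of_nonpos (by linarith) (by linarith) (by norm_num)

/-- The Beta exponents `a` and `1 - a` add up to `1`, so the scaled Beta integral does not depend on
`u`. -/
theorem intervalIntegral_rpow_mul_rpow {a u : ℝ} (ha : 0 < a) (ha1 : a < 1) (hu : 0 < u) :
    ∫ t in (0 : ℝ)..u, ((t ^ (a - 1) : ℝ) : ℂ) * (((u - t) ^ (1 - a - 1) : ℝ) : ℂ) =
      ((Real.Gamma a * Real.Gamma (1 - a) : ℝ) : ℂ) := by
  have h1 := Complex.betaIntegral_scaled (a : ℂ) ((1 - a : ℝ) : ℂ) hu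
  have h2 := Complex.Gamma_mul_Gamma_eq_betaIntegral (s := (a : ℂ)) (t := ((1 - a : ℝ) : ℂ))
    (by simpa using ha) (by simpa using ha1)
  have h3 : (a : ℂ) + ((1 - a : ℝ) : ℂ) = 1 := by push_cast; ring
  rw [h3, sub_self, Complex.cpow_zero, one_mul] at h1
  rw [h3, Complex.Gamma_one, one_mul] at h2
  rw [← h1, Complex.Gamma_ofReal, Complex.Gamma_ofReal] at h2
  rw [Complex.ofReal_mul, h2]
  refine intervalIntegral.integral_congr fun t ht => ?_
  rw [uIcc_of_le hu.le] at ht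
  rw [Complex.ofReal_cpow ht.1, Complex.ofReal_cpow (sub_nonneg.2 ht.2)]
  push_cast
  rfl

namespace Semigroup

variable {X : Type*} [NormedAddCommGroup X] [NormedSpace ℂ X] [CompleteSpace X]
variable {T : Semigroup X} {M : ℝ} (hM : ∀ t, 0 ≤ t → ‖T.op t‖ ≤ M)
variable {Q : X →L[ℂ] X} (hQ : IsResolvent T.generator 0 Q)

/-- The operator `∫₀^∞ t ^ (a - 1) T(t) (-A) ^ (-k) dt = Γ(a) (-A) ^ (-a - k)`, where `Q = (-A)⁻¹`
and `k` is so large that the integral converges. -/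
noncomputable def fracInt (T : Semigroup X) (Q : X →L[ℂ] X) (k : ℕ) (a : ℝ) : X →L[ℂ] X :=
  ∫ t in Ioi (0 : ℝ), ((t ^ (a - 1) : ℝ) : ℂ) • (T.op t * Q ^ k)

section ResolventBounds

include hM

theorem norm_one_sub_smul_res_le {s : ℝ} (hs : 0 < s) :
    ‖1 - (s : ℂ) • res T.generator s‖ ≤ 1 + M := by
  have h1 := norm_res_le hM (z := (s : ℂ)) (by simpa using hs)
  rw [Complex.ofReal_re, le_div_iff₀ hs] at h1
  refine (norm_sub_le _ _).trans (add_le_add ContinuousLinearMap.norm_id_le ?_)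
  rw [norm_smul, Complex.norm_real, Real.norm_of_nonneg hs.le]
  linarith

theorem norm_op_mul_res_le_div {s t : ℝ} (hs : 0 < s) (ht : 0 ≤ t) :
    ‖T.op t * res T.generator s‖ ≤ M ^ 2 / s := by
  have h1 := norm_res_le hM (z := (s : ℂ)) (by simpa using hs)
  rw [Complex.ofReal_re] at h1
  refine (norm_mul_le _ _).trans ((mul_le_mul (hM t ht) h1 (norm_nonneg _)
    (bound_nonneg hM)).trans_eq ?_)
  ring

include hQ

/-- From `R(s, A) = (1 - s R(s, A)) Q` with a uniformly bounded first factor. Unlike `M ^ 2 / s`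
this stays finite as `s → 0` and carries the decay of `T(t) Q`. -/
theorem norm_op_mul_res_le_inverse {s t : ℝ} (hs : 0 < s) (ht : 0 ≤ t) :
    ‖T.op t * res T.generator s‖ ≤ (1 + M) * ‖T.op t * Q‖ := by
  have hs' : 0 < (s : ℂ).re := by simpa using hs
  have hc : Commute (T.op t) (1 - (s : ℂ) • res T.generator s) :=
    (Commute.one_right _).sub_right
      ((commute_res hM hs' fun r hr => T.op_commute ht hr).smul_right _)
  nth_rw 1 [← hQ.one_sub_smul_mul (isResolvent_res hM hs')]
  rw [← mul_assoc, hc.eq, mul_assoc]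
  exact (norm_mul_le _ _).trans
    (mul_le_mul_of_nonneg_right (norm_one_sub_smul_res_le hM hs) (norm_nonneg _))

theorem norm_res_le_inverse {s : ℝ} (hs : 0 < s) : ‖res T.generator s‖ ≤ (1 + M) * ‖Q‖ := by
  simpa [T.op_zero] using norm_op_mul_res_le_inverse hM hQ hs le_rfl

theorem continuousOn_res : ContinuousOn (fun s : ℝ => res T.generator s) (Ioi 0) := by
  have hM0 := bound_nonneg hM
  refine (LipschitzOnWith.of_dist_le_mul (K := (((1 + M) * ‖Q‖) ^ 2).toNNReal)
    fun s hs r hr => ?_).continuousOn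
  have hs' : 0 < s := hs
  have hr' : 0 < r := hr
  rw [Real.coe_toNNReal _ (by positivity), dist_eq_norm, (isResolvent_res hM (by simpa using hs)
    : IsResolvent T.generator (s : ℂ) _).sub_eq (isResolvent_res hM (by simpa using hr)),
    norm_smul, dist_comm, dist_eq_norm, ← Complex.ofReal_sub, Complex.norm_real, mul_comm]
  refine mul_le_mul_of_nonneg_right ((norm_mul_le _ _).trans ?_) (norm_nonneg _)
  rw [pow_two]
  exact mul_le_mul (norm_res_le_inverse hM hQ hs') (norm_res_le_inverse hM hQ hr')
    (norm_nonneg _) (by positivity)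

end ResolventBounds

section Fractional

variable {k : ℕ} (hk : 0 < k) {c : ℝ} (hd : ∀ t, 0 ≤ t → ‖T.op t * Q ^ k‖ ≤ c * (1 + t) ^ (-2 : ℝ))
include hM hQ hk hd

theorem integrableOn_fracInt {a : ℝ} (ha : 0 < a) (ha1 : a ≤ 1) :
    IntegrableOn (fun t : ℝ => ((t ^ (a - 1) : ℝ) : ℂ) • (T.op t * Q ^ k)) (Ioi 0) := by
  refine Integrable.mono' ((integrableOn_rpow_mul_one_add_rpow ha ha1).const_mul c)
    (AEStronglyMeasurable.smul (f := fun t : ℝ => ((t ^ (a - 1) : ℝ) : ℂ)) ?_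
      (aestronglyMeasurable_op_mul_inverse_pow hM hQ hk)) ?_
  · exact (Complex.measurable_ofReal.comp (by fun_prop)).aestronglyMeasurable
  · filter_upwards [ae_restrict_mem measurableSet_Ioi] with t ht
    have ht' : (0 : ℝ) < t := ht
    rw [norm_smul, Complex.norm_real, Real.norm_of_nonneg (by positivity), mul_left_comm]
    exact mul_le_mul_of_nonneg_left (hd t ht'.le) (by positivity)

theorem fracInt_apply {a : ℝ} (ha : 0 < a) (ha1 : a ≤ 1) (x : X) :
    fracInt T Q k a x =
      ∫ t in Ioi (0 : ℝ), ((t ^ (a - 1) : ℝ) : ℂ) • T.op t ((Q ^ k) x) := by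
  rw [fracInt, ContinuousLinearMap.integral_apply (integrableOn_fracInt hM hQ hk hd ha ha1)]
  rfl

theorem commute_fracInt {a : ℝ} (ha : 0 < a) (ha1 : a ≤ 1) {B : X →L[ℂ] X}
    (hB : ∀ t, 0 ≤ t → Commute B (T.op t)) : Commute B (fracInt T Q k a) := by
  have hi := integrableOn_fracInt hM hQ hk hd ha ha1
  have h1 := (ContinuousLinearMap.mul ℂ (X →L[ℂ] X) B).integral_comp_comm hi
  have h2 := ((ContinuousLinearMap.mul ℂ (X →L[ℂ] X)).flip B).integral_comp_comm hi
  simp only [ContinuousLinearMap.mul_apply', ContinuousLinearMap.flip_apply] at h1 h2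
  rw [Commute, SemiconjBy, fracInt, ← h1, ← h2]
  refine setIntegral_congr_fun measurableSet_Ioi fun t ht => ?_
  have : Commute B (T.op t * Q ^ k) :=
    (hB t (le_of_lt ht)).mul_right ((commute_inverse hQ hB).pow_right k)
  simp only [mul_smul_comm, smul_mul_assoc, this.eq]

/-- Abel summation: the integral is the limit as `s → 0` of `R(s, A) Q ^ k x`, and the resolvent
identity with the uniform bound on `R(s, A)` identifies the limit. -/
theorem fracInt_one : fracInt T Q k 1 = Q ^ (k + 1) := by
  have hM0 := bound_nonneg hM
  ext x
  rw [fracInt_apply hM hQ hk hd one_pos le_rfl]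
  have hi : IntegrableOn (fun t => T.op t ((Q ^ k) x)) (Ioi 0) := by
    simpa [IntegrableOn] using (integrableOn_fracInt hM hQ hk hd one_pos le_rfl).apply_continuousLinearMap x
  have h1 : Tendsto (fun s : ℝ => ∫ t in Ioi (0 : ℝ), Complex.exp (-s * t) • T.op t ((Q ^ k) x))
      (𝓝[>] 0) (𝓝 (∫ t in Ioi (0 : ℝ), T.op t ((Q ^ k) x))) := by
    refine tendsto_integral_filter_of_dominated_convergence _ ?_ ?_ hi.norm ?_
    · refine Eventually.of_forall fun s => AEStronglyMeasurable.smul ?_ hi.aestronglyMeasurable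
      exact Continuous.aestronglyMeasurable (by fun_prop)
    · filter_upwards [self_mem_nhdsWithin] with s hs
      filter_upwards [ae_restrict_mem measurableSet_Ioi] with t ht
      rw [norm_smul, Complex.norm_exp]
      refine mul_le_of_le_one_left (norm_nonneg _) (Real.exp_le_one_iff.2 ?_)
      have : 0 < s * t := mul_pos hs ht
      simp
      exact this.le
    · refine Eventually.of_forall fun t => ?_
      have hc : Continuous fun s : ℝ => Complex.exp (-s * t) • T.op t ((Q ^ k) x) := by fun_prop
      simpa using (hc.tendsto 0).mono_left (nhdsWithin_le_nhds (s := Ioi 0))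
  have h2 : Tendsto (fun s : ℝ => ∫ t in Ioi (0 : ℝ), Complex.exp (-s * t) • T.op t ((Q ^ k) x))
      (𝓝[>] 0) (𝓝 ((Q ^ (k + 1)) x)) := by
    rw [tendsto_iff_norm_sub_tendsto_zero]
    have h0 : Tendsto (fun s : ℝ => s * ((1 + M) * ‖Q‖ * ‖(Q ^ (k + 1)) x‖)) (𝓝[>] 0) (𝓝 0) := by
      have hc : Continuous fun s : ℝ => s * ((1 + M) * ‖Q‖ * ‖(Q ^ (k + 1)) x‖) := by fun_prop
      simpa using (hc.tendsto 0).mono_left (nhdsWithin_le_nhds (s := Ioi 0))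
    refine squeeze_zero' (Eventually.of_forall fun _ => norm_nonneg _) ?_ h0
    filter_upwards [self_mem_nhdsWithin] with s hs
    have hs0 : 0 < s := hs
    have hs' : 0 < (s : ℂ).re := by simpa using hs0
    rw [← res_apply hM hs']
    have e := (isResolvent_res hM hs').sub_eq hQ
    have e2 : res T.generator s ((Q ^ k) x) - (Q ^ (k + 1)) x =
        -(s : ℂ) • res T.generator s ((Q ^ (k + 1)) x) := by
      have := DFunLike.congr_fun e ((Q ^ k) x)
      rw [zero_sub] at this
      rw [pow_succ']
      exact this
    rw [e2, norm_smul, norm_neg, Complex.norm_real, Real.norm_of_nonneg hs0.le]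
    exact mul_le_mul_of_nonneg_left
      (ContinuousLinearMap.le_of_opNorm_le _ (norm_res_le_inverse hM hQ hs0) _) hs0.le
  simpa using tendsto_nhds_unique h1 h2

/-- The convolution of `t ^ (a - 1)` and `t ^ (-a)` is the constant `Γ(a) Γ(1 - a)`, so the product
is that multiple of the case `a = 1` with `2 k` in place of `k`. -/
theorem fracInt_mul_fracInt {a : ℝ} (ha : 0 < a) (ha1 : a < 1) :
    fracInt T Q k a * fracInt T Q k (1 - a) =
      ((Real.Gamma a * Real.Gamma (1 - a) : ℝ) : ℂ) • Q ^ (k + k + 1) := by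
  have h := integral_op_mul_integral_op hQ (integrableOn_fracInt hM hQ hk hd ha ha1.le)
    (integrableOn_fracInt hM hQ hk hd (a := 1 - a) (by linarith) (by linarith))
  have hd2 : ∀ t, 0 ≤ t → ‖T.op t * Q ^ (k + k)‖ ≤ (c * ‖Q ^ k‖) * (1 + t) ^ (-2 : ℝ) := by
    intro t ht
    rw [pow_add, ← mul_assoc, mul_right_comm]
    exact (norm_mul_le _ _).trans (mul_le_mul_of_nonneg_right (hd t ht) (norm_nonneg _))
  rw [fracInt, fracInt, h, ← fracInt_one hM hQ (Nat.add_pos_left hk k) hd2, fracInt, ← integral_smul]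
  refine setIntegral_congr_fun measurableSet_Ioi fun u hu => ?_
  simp only [intervalIntegral_rpow_mul_rpow ha ha1 hu]
  simp

/-- Balakrishnan's integral of resolvents, expressed through the semigroup. -/
theorem integral_rpow_smul_res_pow {β : ℝ} (hβ : 0 < β) (m : ℕ) (h0 : 0 < m + 1 - β)
    (h1 : m + 1 - β ≤ 1) (x : X) :
    IntegrableOn (fun s : ℝ => ((s ^ (β - 1) : ℝ) : ℂ) •
        (res T.generator s ^ (m + 1)) ((Q ^ k) x)) (Ioi 0) ∧
      ∫ s in Ioi (0 : ℝ), ((s ^ (β - 1) : ℝ) : ℂ) • (res T.generator s ^ (m + 1)) ((Q ^ k) x) =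
        ((Real.Gamma β / m.factorial : ℝ) : ℂ) • fracInt T Q k (m + 1 - β) x := by
  set y := (Q ^ k) x with hy
  have hJ : IntegrableOn (fun t : ℝ => ((t ^ ((m + 1 - β) - 1) : ℝ) : ℂ) • T.op t y) (Ioi 0) := by
    simpa [IntegrableOn, hy] using (integrableOn_fracInt hM hQ hk hd h0 h1).apply_continuousLinearMap x
  have hm : (m.factorial : ℂ) ≠ 0 := by exact_mod_cast m.factorial_ne_zero
  -- Fubini's theorem for this weight: integrating `w s t T(t) y` in `t` gives `m ! s ^ (β - 1) R(s,
  -- A) ^ (m + 1) y`, while integrating `w s t` in `s` gives `Γ(β) t ^ (m - β)`.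
  set w : ℝ → ℝ → ℝ := fun s t => s ^ (β - 1) * (t ^ m * Real.exp (-(t * s))) with hw
  have hmeas : Measurable fun p : ℝ × ℝ => w p.1 p.2 := by fun_prop
  have hws : ∀ t : ℝ, 0 < t → ∫ s in Ioi (0 : ℝ), w s t =
      Real.Gamma β * t ^ ((m + 1 - β) - 1) := by
    intro t ht
    have h2 : ∀ s, w s t = t ^ m * (s ^ (β - 1) * Real.exp (-(t * s))) := fun s => by
      simp only [hw]; ring
    simp only [h2]
    rw [integral_const_mul, Real.integral_rpow_mul_exp_neg_mul_Ioi hβ ht, one_div,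
      Real.inv_rpow ht.le, ← Real.rpow_neg ht.le, ← mul_assoc, ← Real.rpow_natCast,
      ← Real.rpow_add ht, mul_comm]
    congr 2
    ring
  have hwi : ∀ t : ℝ, 0 < t → IntegrableOn (fun s => w s t) (Ioi 0) := by
    intro t ht
    -- The integral of a non-integrable function is `0` by convention, whereas this one is positive.
    by_contra hcon
    have := hws t ht
    rw [integral_undef hcon] at this
    have : 0 < Real.Gamma β * t ^ ((m + 1 - β) - 1) :=
      mul_pos (Real.Gamma_pos_of_pos hβ) (Real.rpow_pos_of_pos ht _)
    linarith
  have hF : Integrable (fun p : ℝ × ℝ => ((w p.1 p.2 : ℝ) : ℂ) • T.op p.2 y)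
      ((volume.restrict (Ioi 0)).prod (volume.restrict (Ioi 0))) := by
    have hTm : AEStronglyMeasurable (fun t => T.op t y) (volume.restrict (Ioi 0)) :=
      ((continuousOn_op_apply hM y).mono Ioi_subset_Ici_self).aestronglyMeasurable
        measurableSet_Ioi
    have hsm : AEStronglyMeasurable (fun p : ℝ × ℝ => ((w p.1 p.2 : ℝ) : ℂ) • T.op p.2 y)
        ((volume.restrict (Ioi 0)).prod (volume.restrict (Ioi 0))) :=
      ((Complex.measurable_ofReal.comp hmeas).aestronglyMeasurable).smul hTm.comp_snd
    rw [integrable_prod_iff' hsm]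
    constructor
    · filter_upwards [ae_restrict_mem measurableSet_Ioi] with t ht
      exact ((hwi t ht).ofReal (𝕜 := ℂ)).smul_const (T.op t y)
    · refine (hJ.norm.const_mul (Real.Gamma β)).congr ?_
      filter_upwards [ae_restrict_mem measurableSet_Ioi] with t ht
      have ht' : (0 : ℝ) < t := ht
      rw [norm_smul, Complex.norm_real, Real.norm_of_nonneg (Real.rpow_nonneg ht'.le _),
        ← mul_assoc, ← hws t ht, ← integral_mul_const]
      refine setIntegral_congr_fun measurableSet_Ioi fun s hs => ?_
      have hs' : (0 : ℝ) < s := hs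
      rw [norm_smul, Complex.norm_real, Real.norm_of_nonneg (by positivity)]
  have hin : ∀ s : ℝ, 0 < s → ∫ t in Ioi (0 : ℝ), ((w s t : ℝ) : ℂ) • T.op t y =
      (m.factorial : ℂ) • (((s ^ (β - 1) : ℝ) : ℂ) • (res T.generator s ^ (m + 1)) y) := by
    intro s hs
    rw [smul_comm, ← integral_pow_mul_cexp_smul_op hM hQ (z := (s : ℂ)) (by simpa using hs),
      ← integral_smul]
    refine setIntegral_congr_fun measurableSet_Ioi fun t _ => ?_
    rw [smul_smul]
    congr 1
    change ((s ^ (β - 1) * (t ^ m * Real.exp (-(t * s))) : ℝ) : ℂ) = _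
    push_cast
    rw [neg_mul, mul_comm (t : ℂ) s]
  have hcongr : (fun s => ∫ t in Ioi (0 : ℝ), ((w s t : ℝ) : ℂ) • T.op t y)
      =ᵐ[volume.restrict (Ioi 0)] fun s => (m.factorial : ℂ) •
        (((s ^ (β - 1) : ℝ) : ℂ) • (res T.generator s ^ (m + 1)) y) := by
    filter_upwards [ae_restrict_mem measurableSet_Ioi] with s hs using hin s hs
  have hL := hF.integral_prod_left.congr hcongr
  refine ⟨(integrable_smul_iff hm _).1 hL, ?_⟩
  have hswap := integral_integral_swap
    (f := fun s t : ℝ => ((w s t : ℝ) : ℂ) • T.op t y) hF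
  rw [integral_congr_ae hcongr, integral_smul] at hswap
  have hR : ∫ t in Ioi (0 : ℝ), ∫ s in Ioi (0 : ℝ), ((w s t : ℝ) : ℂ) • T.op t y =
      (Real.Gamma β : ℂ) • fracInt T Q k (m + 1 - β) x := by
    rw [fracInt_apply hM hQ hk hd h0 h1, ← integral_smul]
    refine setIntegral_congr_fun measurableSet_Ioi fun t ht => ?_
    rw [integral_smul_const, integral_complex_ofReal, hws t ht, smul_smul,
      Complex.ofReal_mul]
  rw [hR, ← eq_inv_smul_iff₀ hm] at hswap
  rw [hswap, smul_smul]
  congr 1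
  push_cast
  ring

end Fractional

end Semigroup

/-- An interpolation estimate for `∫₀^∞ s ^ (-a) g(s) ds`. -/
theorem norm_integral_rpow_smul_le {E : Type*} [NormedAddCommGroup E] [NormedSpace ℂ E]
    {g : ℝ → E} (hg : AEStronglyMeasurable g (volume.restrict (Ioi 0))) {a q N S : ℝ}
    (ha : 0 < a) (ha1 : a < 1) (hS : 0 < S) (hq : ∀ s, 0 < s → ‖g s‖ ≤ q)
    (hN : ∀ s, 0 < s → ‖g s‖ ≤ N / s) :
    IntegrableOn (fun s => ((s ^ (-a) : ℝ) : ℂ) • g s) (Ioi 0) ∧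
      ‖∫ s in Ioi (0 : ℝ), ((s ^ (-a) : ℝ) : ℂ) • g s‖ ≤
        q * (S ^ (1 - a) / (1 - a)) + N * (S ^ (-a) / a) := by
  have hm : AEStronglyMeasurable (fun s => ((s ^ (-a) : ℝ) : ℂ) • g s)
      (volume.restrict (Ioi 0)) :=
    AEStronglyMeasurable.smul (f := fun s : ℝ => ((s ^ (-a) : ℝ) : ℂ))
      (Complex.measurable_ofReal.comp (by fun_prop)).aestronglyMeasurable hg
  have hi1 : IntegrableOn (fun s : ℝ => q * s ^ (-a)) (Ioc 0 S) := by
    refine Integrable.const_mul ?_ q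
    exact (intervalIntegrable_iff_integrableOn_Ioc_of_le hS.le).1
      (intervalIntegral.intervalIntegrable_rpow' (by linarith))
  have hi2 : IntegrableOn (fun s : ℝ => N * s ^ (-a - 1)) (Ioi S) :=
    (integrableOn_Ioi_rpow_of_lt (by linarith) hS).const_mul N
  have hb1 : ∀ᵐ s ∂(volume.restrict (Ioc 0 S)), ‖((s ^ (-a) : ℝ) : ℂ) • g s‖ ≤ q * s ^ (-a) := by
    filter_upwards [ae_restrict_mem measurableSet_Ioc] with s hs
    have h0 : 0 < s ^ (-a) := Real.rpow_pos_of_pos hs.1 _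
    rw [norm_smul, Complex.norm_real, Real.norm_of_nonneg h0.le, mul_comm]
    exact mul_le_mul_of_nonneg_right (hq s hs.1) h0.le
  have hb2 : ∀ᵐ s ∂(volume.restrict (Ioi S)),
      ‖((s ^ (-a) : ℝ) : ℂ) • g s‖ ≤ N * s ^ (-a - 1) := by
    filter_upwards [ae_restrict_mem measurableSet_Ioi] with s hs
    have hs0 : 0 < s := hS.trans hs
    have h0 : 0 < s ^ (-a) := Real.rpow_pos_of_pos hs0 _
    rw [norm_smul, Complex.norm_real, Real.norm_of_nonneg h0.le, Real.rpow_sub_one hs0.ne',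
      mul_div_assoc', mul_comm N, mul_div_assoc]
    exact mul_le_mul_of_nonneg_left (hN s hs0) h0.le
  have hg1 : IntegrableOn (fun s => ((s ^ (-a) : ℝ) : ℂ) • g s) (Ioc 0 S) :=
    Integrable.mono' hi1 (hm.mono_measure (Measure.restrict_mono Ioc_subset_Ioi_self le_rfl)) hb1
  have hg2 : IntegrableOn (fun s => ((s ^ (-a) : ℝ) : ℂ) • g s) (Ioi S) :=
    Integrable.mono' hi2 (hm.mono_measure (Measure.restrict_mono (Ioi_subset_Ioi hS.le) le_rfl)) hb2
  rw [← Ioc_union_Ioi_eq_Ioi hS.le]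
  refine ⟨hg1.union hg2, ?_⟩
  rw [setIntegral_union (Ioc_disjoint_Ioi le_rfl) measurableSet_Ioi hg1 hg2]
  refine (norm_add_le _ _).trans (add_le_add ?_ ?_)
  · refine (norm_integral_le_of_norm_le hi1 hb1).trans_eq ?_
    rw [integral_const_mul, ← intervalIntegral.integral_of_le hS.le,
      integral_rpow (Or.inl (by linarith)), Real.zero_rpow (by linarith), sub_zero,
      neg_add_eq_sub]
  · refine (norm_integral_le_of_norm_le hi2 hb2).trans_eq ?_
    rw [integral_const_mul, integral_Ioi_rpow_of_lt (by linarith) hS, sub_add_cancel]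
    field_simp

/-! ### The factorization `C = E (-A) ^ (-α)` and its decay -/

namespace Semigroup

section Factor

variable {X : Type*} [NormedAddCommGroup X] [NormedSpace ℂ X] [CompleteSpace X]
variable {T : Semigroup X} {M : ℝ} (hM : ∀ t, 0 ≤ t → ‖T.op t‖ ≤ M)
variable {Q : X →L[ℂ] X} (hQ : IsResolvent T.generator 0 Q)
include hM hQ

/-- The bounded operator `F = ∫₀^∞ s ^ (-a) R(s, A) ds`, a multiple of `(-A) ^ (-a)`. -/
theorem exists_resolvent_integral {a : ℝ} (ha : 0 < a) (ha1 : a < 1) {c₀ δ : ℝ} (hc₀ : 0 < c₀)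
    (hd₀ : ∀ t, 0 ≤ t → ‖T.op t * Q‖ ≤ c₀ * (1 + t) ^ (-δ)) (hδ : 0 < δ)
    {k : ℕ} (hk : 0 < k) {c : ℝ}
    (hd : ∀ t, 0 ≤ t → ‖T.op t * Q ^ k‖ ≤ c * (1 + t) ^ (-2 : ℝ)) :
    ∃ F : X →L[ℂ] X, Commute F Q ∧
      (∀ x, F ((Q ^ k) x) = ((Real.Gamma (1 - a) : ℝ) : ℂ) • fracInt T Q k a x) ∧
      ∃ C : ℝ, 0 ≤ C ∧ ∀ t, 0 < t → ‖T.op t * F‖ ≤ C * t ^ (-(δ * a)) := by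
  have hM0 := bound_nonneg hM
  have hsm : AEStronglyMeasurable (fun s : ℝ => res T.generator s) (volume.restrict (Ioi 0)) :=
    (continuousOn_res hM hQ).aestronglyMeasurable measurableSet_Ioi
  have hi : IntegrableOn (fun s : ℝ => ((s ^ (-a) : ℝ) : ℂ) • res T.generator s) (Ioi 0) := by
    refine (norm_integral_rpow_smul_le hsm ha ha1 one_pos
      (fun s hs => norm_res_le_inverse hM hQ hs) (N := M) (fun s hs => ?_)).1
    simpa using norm_res_le hM (z := (s : ℂ)) (by simpa using hs)
  have hmul : ∀ B : X →L[ℂ] X, B * (∫ s in Ioi (0 : ℝ), ((s ^ (-a) : ℝ) : ℂ) • res T.generator s) =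
      ∫ s in Ioi (0 : ℝ), ((s ^ (-a) : ℝ) : ℂ) • (B * res T.generator s) := by
    intro B
    have h1 := (ContinuousLinearMap.mul ℂ (X →L[ℂ] X) B).integral_comp_comm hi
    simp only [ContinuousLinearMap.mul_apply', mul_smul_comm] at h1
    exact h1.symm
  refine ⟨∫ s in Ioi (0 : ℝ), ((s ^ (-a) : ℝ) : ℂ) • res T.generator s, ?_, fun x => ?_,
    (1 + M) * c₀ / (1 - a) + M ^ 2 / a, ?_, fun t ht => ?_⟩
  · have h2 := ((ContinuousLinearMap.mul ℂ (X →L[ℂ] X)).flip Q).integral_comp_comm hi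
    simp only [ContinuousLinearMap.mul_apply', ContinuousLinearMap.flip_apply,
      smul_mul_assoc] at h2
    rw [Commute, SemiconjBy, hmul, ← h2]
    refine setIntegral_congr_fun measurableSet_Ioi fun s hs => ?_
    have hs' : 0 < (s : ℂ).re := by simpa using hs
    have : Commute Q (res T.generator s) :=
      commute_res hM hs' fun t ht => (op_commute_inverse hQ ht).symm
    simp only [this.eq]
  · have h := (integral_rpow_smul_res_pow hM hQ hk hd (β := 1 - a) (by linarith) 0
      (by push_cast; linarith) (by push_cast; linarith) x).2
    rw [ContinuousLinearMap.integral_apply hi]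
    have e1 : ((0 : ℕ) : ℝ) + 1 - (1 - a) = a := by push_cast; ring
    have e2 : 1 - a - 1 = -a := by ring
    rw [e1, e2] at h
    simpa using h
  · have : 0 < 1 - a := by linarith
    positivity
  · have ht1 : 0 < 1 - a := by linarith
    -- Cutting at `t ^ δ` balances the bounds `t ^ (-δ)` and `1 / s` on `‖T(t) R(s, A)‖`; both
    -- pieces are then of order `t ^ (-δ a)`.
    have hS : 0 < t ^ δ := Real.rpow_pos_of_pos ht _
    have h := (norm_integral_rpow_smul_le (g := fun s : ℝ => T.op t * res T.generator s)
      (hsm.const_mul _) ha ha1 hS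
      (fun s hs => norm_op_mul_res_le_inverse hM hQ hs ht.le)
      (fun s hs => norm_op_mul_res_le_div hM hs ht.le)).2
    rw [hmul]
    refine h.trans ?_
    have e1 : (t ^ δ) ^ (1 - a) = t ^ δ * t ^ (-(δ * a)) := by
      rw [← Real.rpow_mul ht.le, ← Real.rpow_add ht]
      ring_nf
    have e2 : (t ^ δ) ^ (-a) = t ^ (-(δ * a)) := by
      rw [← Real.rpow_mul ht.le]
      ring_nf
    have e3 : ‖T.op t * Q‖ * t ^ δ ≤ c₀ := by
      have h1 : (1 + t) ^ (-δ) ≤ t ^ (-δ) :=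
        Real.rpow_le_rpow_of_nonpos ht (by linarith) (by linarith)
      have h2 : t ^ (-δ) * t ^ δ = 1 := by rw [← Real.rpow_add ht]; simp
      calc ‖T.op t * Q‖ * t ^ δ ≤ (c₀ * t ^ (-δ)) * t ^ δ := by
            gcongr
            exact (hd₀ t ht.le).trans (mul_le_mul_of_nonneg_left h1 hc₀.le)
        _ = c₀ := by rw [mul_assoc, h2, mul_one]
    rw [e1, e2]
    have hp : 0 < t ^ (-(δ * a)) := Real.rpow_pos_of_pos ht _
    calc _ = (1 + M) * (‖T.op t * Q‖ * t ^ δ) / (1 - a) * t ^ (-(δ * a)) +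
          M ^ 2 / a * t ^ (-(δ * a)) := by ring
      _ ≤ (1 + M) * c₀ / (1 - a) * t ^ (-(δ * a)) + M ^ 2 / a * t ^ (-(δ * a)) := by gcongr
      _ = _ := by ring

/-- If `W = E (-A)⁻¹`, `V = C (-A)⁻¹` and `E = C (-A) ^ α` on smooth vectors, then `C = E G` with
an operator `G` along which the semigroup decays polynomially. -/
theorem exists_factor {c₀ δ : ℝ} (hc₀ : 0 < c₀)
    (hd₀ : ∀ t, 0 ≤ t → ‖T.op t * Q‖ ≤ c₀ * (1 + t) ^ (-δ)) (hδ : 0 < δ)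
    {k : ℕ} (hk : 0 < k) {c : ℝ}
    (hd : ∀ t, 0 ≤ t → ‖T.op t * Q ^ k‖ ≤ c * (1 + t) ^ (-2 : ℝ))
    {V W : X →L[ℂ] X} {α : ℝ} (hα : 0 < α)
    (hVW : ∀ x, V (fracInt T Q k (⌊α⌋₊ + 1 - α) x) =
      ((Real.Gamma (⌊α⌋₊ + 1 - α) : ℝ) : ℂ) • W ((Q ^ (⌊α⌋₊ + 1 + k)) x)) :
    ∃ G : X →L[ℂ] X, V = W * G ∧ ∃ C ε : ℝ, 0 < ε ∧ 0 ≤ C ∧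
      ∀ t, 0 < t → ‖T.op t * G‖ ≤ C * t ^ (-ε) := by
  have hfl := Nat.floor_le hα.le
  have hfl' := Nat.lt_floor_add_one α
  set m := ⌊α⌋₊ with hm
  rcases eq_or_lt_of_le hfl with heq | hlt
  -- For an integer `α = m ≥ 1`, `G = Q ^ m` and one factor `Q` supplies the decay.
  · have hγ : (m : ℝ) + 1 - α = 1 := by linarith
    rw [hγ, fracInt_one hM hQ hk hd, Real.Gamma_one] at hVW
    have hm0 : m ≠ 0 := by
      rintro h0
      rw [h0] at heq
      simp at heq
      linarith
    obtain ⟨l, hl⟩ := Nat.exists_eq_succ_of_ne_zero hm0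
    refine ⟨Q ^ m, eq_of_mul_inverse_pow hM hQ (k := k + 1) fun x => ?_, c₀ * ‖Q ^ l‖, δ, hδ,
      by positivity, fun t ht => ?_⟩
    · rw [hVW]
      have : m + 1 + k = m + (k + 1) := by ring
      rw [this, pow_add, Complex.ofReal_one, one_smul]
      rfl
    · rw [hl, Nat.succ_eq_add_one, pow_succ', ← mul_assoc]
      refine (norm_mul_le _ _).trans ?_
      rw [mul_right_comm]
      refine mul_le_mul_of_nonneg_right ((hd₀ t ht.le).trans ?_) (norm_nonneg _)
      exact mul_le_mul_of_nonneg_left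
        (Real.rpow_le_rpow_of_nonpos ht (by linarith) (by linarith)) hc₀.le
  -- Otherwise `1 - γ = α - m` is the fractional part of `α`, `F` is `κ (-A) ^ (-(1 - γ))` with `κ =
  -- Γ(γ) Γ(1 - γ)`, and `G = κ⁻¹ F Q ^ m` is `(-A) ^ (-α)`.
  · set γ := (m : ℝ) + 1 - α with hγ
    have hγ0 : 0 < γ := by linarith
    have hγ1 : γ < 1 := by linarith
    have hGγ := Real.Gamma_pos_of_pos hγ0
    have hGa := Real.Gamma_pos_of_pos (show 0 < 1 - γ by linarith)
    obtain ⟨F, hFQ, hF, C, hC, hFd⟩ := exists_resolvent_integral hM hQ (a := 1 - γ)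
      (by linarith) (by linarith) hc₀ hd₀ hδ hk hd
    rw [sub_sub_cancel] at hF
    set κ : ℂ := ((Real.Gamma γ * Real.Gamma (1 - γ) : ℝ) : ℂ) with hκ
    have hκ0 : κ ≠ 0 := by
      rw [hκ]
      exact_mod_cast (mul_pos hGγ hGa).ne'
    refine ⟨κ⁻¹ • (F * Q ^ m), eq_of_mul_inverse_pow hM hQ (k := k + k + 1) fun x => ?_,
      ‖κ⁻¹‖ * (C * ‖Q ^ m‖), δ * (1 - γ), by nlinarith, by positivity, fun t ht => ?_⟩
    -- The complementary power turns the left side into `κ V Q ^ (2 k + 1) x`, freeing `V` of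
    -- fractional powers.
    · have h1 := hVW (fracInt T Q k (1 - γ) x)
      have h2 : fracInt T Q k γ (fracInt T Q k (1 - γ) x) = κ • (Q ^ (k + k + 1)) x :=
        DFunLike.congr_fun (fracInt_mul_fracInt hM hQ hk hd hγ0 hγ1) x
      rw [h2, map_smul, ← eq_inv_smul_iff₀ hκ0] at h1
      rw [h1]
      have h3 : (Q ^ (m + 1 + k)) (((Real.Gamma γ : ℝ) : ℂ) • fracInt T Q k (1 - γ) x) =
          (F * Q ^ m) ((Q ^ (k + k + 1)) x) := by
        rw [← hF]
        have : Q ^ (m + 1 + k) * (F * Q ^ k) = F * Q ^ m * Q ^ (k + k + 1) := by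
          rw [← mul_assoc, ← (hFQ.pow_right _).eq, mul_assoc, mul_assoc, ← pow_add, ← pow_add]
          congr 2
          ring
        exact DFunLike.congr_fun this x
      change _ = W (κ⁻¹ • (F * Q ^ m) ((Q ^ (k + k + 1)) x))
      rw [← h3, map_smul, map_smul, map_smul]
    · rw [mul_smul_comm, norm_smul, mul_assoc, ← mul_assoc (T.op t), mul_right_comm C]
      refine mul_le_mul_of_nonneg_left ((norm_mul_le _ _).trans ?_) (norm_nonneg _)
      exact mul_le_mul_of_nonneg_right (hFd t ht) (norm_nonneg _)

/-- The factor `Q ^ (m + 1)` cancels the powers of `-A` in Balakrishnan's integrand, leaving `R(s,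
A) ^ (m + 1) Q ^ k x`. The Gamma factors then combine so that the value is `(-A) ^ (α - m - 1 - k)
x`, where `m = ⌊α⌋₊`. -/
theorem balakrishnan_inverse_pow {k : ℕ} (hk : 0 < k) {c : ℝ}
    (hd : ∀ t, 0 ≤ t → ‖T.op t * Q ^ k‖ ≤ c * (1 + t) ^ (-2 : ℝ)) {α : ℝ} (hα : 0 < α) (x : X) :
    ∃ h : (Q ^ (⌊α⌋₊ + 1 + k)) x ∈ (balakrishnan T.generator α).domain,
      balakrishnan T.generator α ⟨_, h⟩ =
        ((Real.Gamma (⌊α⌋₊ + 1 - α) : ℝ) : ℂ)⁻¹ • fracInt T Q k (⌊α⌋₊ + 1 - α) x := by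
  have hfl := Nat.floor_le hα.le
  have hfl' := Nat.lt_floor_add_one α
  set m := ⌊α⌋₊ with hm
  obtain ⟨h1, h2⟩ := integral_rpow_smul_res_pow hM hQ hk hd hα m (by linarith) (by linarith) x
  have hx : (Q ^ (m + 1 + k)) x = (Q ^ (m + 1)) ((Q ^ k) x) := by rw [pow_add]; rfl
  have hint : EqOn (balakrishnanIntegrand T.generator α (m + 1) ((Q ^ (m + 1 + k)) x))
      (fun s : ℝ => ((s ^ (α - 1) : ℝ) : ℂ) • (res T.generator s ^ (m + 1)) ((Q ^ k) x))
      (Ioi 0) := by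
    intro s hs
    have hs' : 0 < (s : ℂ).re := by simpa using hs
    have hR := isResolvent_res hM hs'
    have hRQ : Commute (1 - (s : ℂ) • res T.generator s) Q :=
      (Commute.one_left _).sub_left (Commute.smul_left
        (commute_res hM hs' fun t ht => (op_commute_inverse hQ ht).symm).symm _)
    have e : (1 - (s : ℂ) • res T.generator s) ^ (m + 1) * Q ^ (m + 1) =
        res T.generator s ^ (m + 1) := by
      rw [← hRQ.mul_pow, hQ.one_sub_smul_mul hR]
    simp only [balakrishnanIntegrand]
    rw [hx, ← e]
    rfl
  refine ⟨⟨?_, ?_⟩, ?_⟩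
  · rw [hx]
    exact hQ.pow_mem_domPow (m + 1) _
  · exact h1.congr_fun hint.symm measurableSet_Ioi
  · change ((Real.Gamma ((m + 1 : ℕ) : ℝ) /
      (Real.Gamma α * Real.Gamma (((m + 1 : ℕ) : ℝ) - α)) : ℝ) : ℂ) •
        ∫ s in Ioi (0 : ℝ), balakrishnanIntegrand T.generator α (m + 1) _ s = _
    rw [setIntegral_congr_fun measurableSet_Ioi hint, h2, smul_smul]
    congr 1
    have hG := (Real.Gamma_pos_of_pos hα).ne'
    have hf : (m.factorial : ℝ) ≠ 0 := by exact_mod_cast m.factorial_ne_zero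
    push_cast
    rw [← Complex.ofReal_natCast, ← Complex.ofReal_inv]
    norm_cast
    rw [Nat.cast_succ, Real.Gamma_nat_eq_factorial]
    field_simp

end Factor

end Semigroup

/-- A graph bounded operator `C` on `D(A)` is represented by the bounded operator `C (-A)⁻¹`. -/
theorem GraphBounded.exists_mul_inverse {X Y : Type*} [NormedAddCommGroup X] [NormedSpace ℂ X]
    [NormedAddCommGroup Y] [NormedSpace ℂ Y] {A : X →ₗ.[ℂ] X} {C : A.domain →ₗ[ℂ] Y}
    (hC : GraphBounded A C) {Q : X →L[ℂ] X} (hQ : IsResolvent A 0 Q) :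
    ∃ V : X →L[ℂ] Y, ∀ x (h : Q x ∈ A.domain), V x = C ⟨Q x, h⟩ := by
  obtain ⟨c, hc⟩ := hC
  refine ⟨(C ∘ₗ (Q : X →ₗ[ℂ] X).codRestrict A.domain hQ.mem_domain).mkContinuous
    (|c| * (‖Q‖ + 1)) fun x => ?_, fun x h => rfl⟩
  refine (hc ⟨Q x, hQ.mem_domain x⟩).trans ?_
  rw [hQ.apply_zero, norm_neg, mul_assoc, add_mul, one_mul]
  exact mul_le_mul (le_abs_self c) (by gcongr; exact Q.le_opNorm x) (by positivity) (abs_nonneg c)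

/-! ### The bounded extension of `C T(t)` -/

namespace Semigroup

/-- The extension is `E T(t / 2) · T(t / 2) G`: half of the time pays for the unboundedness of `E`,
the other half gains the decay along `G`. The condition `T(t) x = Q y` expresses `T(t) x ∈ D(A)`,
with `V y = C T(t) x`. -/
theorem exists_extension_of_factor {X : Type*} [NormedAddCommGroup X] [InnerProductSpace ℂ X]
    [CompleteSpace X] {T : Semigroup X} {M : ℝ} (hM : ∀ t, 0 ≤ t → ‖T.op t‖ ≤ M)
    {Q : X →L[ℂ] X} (hQ : IsResolvent T.generator 0 Q) {V W G : X →L[ℂ] X}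
    (hV : ∀ t, 0 ≤ t → Commute V (T.op t)) (hW : ∀ t, 0 ≤ t → Commute W (T.op t))
    {K : ℝ} (hK : 0 < K)
    (hWK : ∀ z : ℂ, 0 < z.re → ∀ x,
      ‖W ((1 - z • res T.generator z) x)‖ ≤ K / z.re ^ (1 / 2 : ℝ) * ‖x‖)
    (hG : V = W * G) {C ε : ℝ} (hTG : ∀ t, 0 < t → ‖T.op t * G‖ ≤ C * t ^ (-ε))
    {t : ℝ} (ht : 0 < t) :
    ∃ B : X →L[ℂ] X, (∀ x y, T.op t x = Q y → B x = V y) ∧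
      ‖B‖ ≤ 4 * M ^ 2 * K * C * (t / 2) ^ (-(1 / 2 + ε)) := by
  have ht2 : 0 < t / 2 := half_pos ht
  have hM0 := bound_nonneg hM
  have hdense : DenseRange (Q : X →ₗ[ℂ] X) := denseRange_inverse hM hQ
  have hb : ∀ x, ‖((W * T.op (t / 2) : X →L[ℂ] X) : X →ₗ[ℂ] X) x‖ ≤
      4 * M ^ 2 * K * (t / 2) ^ (-(1 / 2) : ℝ) * ‖(Q : X →ₗ[ℂ] X) x‖ := fun x =>
    norm_apply_op_le_of_weiss hM hQ hW hK hWK ht2 x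
  -- `S` is the extension of `E T(t / 2)`: the map `Q x ↦ W T(t / 2) x` is bounded on the dense
  -- range of `Q` by the Weiss estimate.
  set S : X →L[ℂ] X :=
    ((W * T.op (t / 2) : X →L[ℂ] X) : X →ₗ[ℂ] X).extendOfNorm (Q : X →ₗ[ℂ] X) with hS
  have hSQ : S * Q = W * T.op (t / 2) := by
    ext x
    exact LinearMap.extendOfNorm_eq hdense ⟨_, hb⟩ x
  have hSn : ‖S‖ ≤ 4 * M ^ 2 * K * (t / 2) ^ (-(1 / 2) : ℝ) :=
    LinearMap.opNorm_extendOfNorm_le hdense (by positivity) hb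
  have hTQ : Commute (T.op (t / 2)) Q := op_commute_inverse hQ ht2.le
  have hWQ : Commute W Q := commute_inverse hQ hW
  have hVQ : Commute V Q := commute_inverse hQ hV
  have hSQc : Commute S Q := by
    refine eq_of_mul_inverse_pow hM hQ (k := 1) fun w => ?_
    have : S * Q * Q = Q * S * Q := by
      rw [hSQ, mul_assoc Q, hSQ, (hWQ.mul_left hTQ).eq]
    rw [pow_one]
    exact DFunLike.congr_fun this w
  refine ⟨S * (T.op (t / 2) * G), fun x y hxy => hQ.injective_zero ?_, ?_⟩
  · have h1 : Q * (S * (T.op (t / 2) * G)) = V * T.op t := by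
      rw [← mul_assoc, ← hSQc.eq, hSQ, mul_assoc, ← mul_assoc (T.op (t / 2)),
        ← T.op_add _ _ ht2.le ht2.le, add_halves, ← mul_assoc, (hW t ht.le).eq, mul_assoc, ← hG,
        (hV t ht.le).eq]
    have h2 : Q ((S * (T.op (t / 2) * G)) x) = V (T.op t x) := DFunLike.congr_fun h1 x
    rw [h2, hxy]
    exact DFunLike.congr_fun hVQ.eq y
  · calc ‖S * (T.op (t / 2) * G)‖ ≤ ‖S‖ * ‖T.op (t / 2) * G‖ := norm_mul_le _ _
      _ ≤ (4 * M ^ 2 * K * (t / 2) ^ (-(1 / 2) : ℝ)) * (C * (t / 2) ^ (-ε)) := by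
          gcongr
          exact hTG _ ht2
      _ = _ := by
          rw [neg_add, Real.rpow_add ht2]
          ring

end Semigroup

end C0

/-! ### Proof of the theorem -/

theorem mainTheorem11 {X : Type*} [NormedAddCommGroup X] [InnerProductSpace ℂ X] [CompleteSpace X]
    (T : C0.Semigroup X) (hT : T.IsPolynomiallyStable)
    (C : T.generator.domain →ₗ[ℂ] X) (hC : C0.GraphBounded T.generator C)
    (hcomm : ∀ t : ℝ, 0 ≤ t → C0.Commutes (T.op t) ⟨T.generator.domain, C⟩)
    (hW : C0.StrongTwoWeissCondition T.generator C) :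
    ∃ CT : ℝ → X →L[ℂ] X,
      (∀ t : ℝ, 0 < t → ∀ (x : X) (hx : T.op t x ∈ T.generator.domain),
        CT t x = C ⟨T.op t x, hx⟩) ∧
      ∃ M β : ℝ, 0 < M ∧ 0 < β ∧
        ∀ t : ℝ, 0 < t → ‖CT t‖ ≤ M / √(t ^ (1 + β)) := by
  obtain ⟨⟨M, hM⟩, α₀, hα₀, hO⟩ := hT
  obtain ⟨α, hα, E, hE, hEC, K, hK, hEK⟩ := hW
  have hdecay : Tendsto (fun t => ‖T.op t * C0.res T.generator 1‖) atTop (𝓝 0) :=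
    hO.trans_tendsto (tendsto_rpow_neg_atTop (one_div_pos.2 hα₀))
      |>.congr fun t => rfl
  obtain ⟨Q, hQ⟩ := C0.Semigroup.zero_mem_resSet hM hdecay
  obtain ⟨c₀, hc₀, hd₀⟩ :=
    C0.Semigroup.exists_norm_op_mul_inverse_le hM hQ (one_div_pos.2 hα₀) hO
  obtain ⟨k, c, hk, -, hd⟩ :=
    C0.Semigroup.exists_norm_op_mul_inverse_pow_le hQ (one_div_pos.2 hα₀) hd₀
  obtain ⟨V, hV⟩ := hC.exists_mul_inverse hQ
  obtain ⟨W, hW⟩ := hE.exists_mul_inverse hQ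
  have hfl := Nat.floor_le hα.le
  have hfl' := Nat.lt_floor_add_one α
  have hγ0 : 0 < (⌊α⌋₊ : ℝ) + 1 - α := by linarith
  have hγ1 : (⌊α⌋₊ : ℝ) + 1 - α ≤ 1 := by linarith
  have hΓ : ((Real.Gamma (⌊α⌋₊ + 1 - α) : ℝ) : ℂ) ≠ 0 := by
    exact_mod_cast (Real.Gamma_pos_of_pos hγ0).ne'
  set J := C0.Semigroup.fracInt T Q k (⌊α⌋₊ + 1 - α) with hJ
  have hJQ : Commute Q J := C0.Semigroup.commute_fracInt hM hQ hk hd hγ0 hγ1 fun t ht =>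
    (C0.Semigroup.op_commute_inverse hQ ht).symm
  have hVW : ∀ x, V (J x) = ((Real.Gamma (⌊α⌋₊ + 1 - α) : ℝ) : ℂ) • W ((Q ^ (⌊α⌋₊ + 1 + k)) x) := by
    intro x
    -- Evaluating at `Q x` instead of `x` puts the fractional power of the vector in `D(A)`, as the
    -- extension property of `E` requires.
    obtain ⟨h1, h2⟩ := C0.Semigroup.balakrishnan_inverse_pow hM hQ hk hd hα (Q x)
    have hle := LinearPMap.le_closure (C0.balakrishnan T.generator α)
    have h3 : C0.negFracPow T.generator α ⟨_, hle.1 h1⟩ =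
        Q (((Real.Gamma (⌊α⌋₊ + 1 - α) : ℝ) : ℂ)⁻¹ • J x) := by
      have h4 : C0.negFracPow T.generator α ⟨_, hle.1 h1⟩ = C0.balakrishnan T.generator α ⟨_, h1⟩ :=
        (hle.2 rfl).symm
      rw [h4, h2, map_smul]
      congr 1
      exact (DFunLike.congr_fun hJQ.eq x).symm
    obtain ⟨h5, h6⟩ := hEC ⟨_, hle.1 h1⟩ (by rw [h3]; exact hQ.mem_domain _)
    have h7 : (Q ^ (⌊α⌋₊ + 1 + k)) (Q x) = Q ((Q ^ (⌊α⌋₊ + 1 + k)) x) :=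
      DFunLike.congr_fun ((Commute.refl Q).pow_left (⌊α⌋₊ + 1 + k)).eq x
    have h8 : W ((Q ^ (⌊α⌋₊ + 1 + k)) x) =
        V (((Real.Gamma (⌊α⌋₊ + 1 - α) : ℝ) : ℂ)⁻¹ • J x) := by
      rw [hV _ (hQ.mem_domain _), hW _ (hQ.mem_domain _)]
      exact (congrArg E (Subtype.ext h7.symm)).trans (h6.trans (congrArg C (Subtype.ext h3)))
    rw [map_smul, eq_inv_smul_iff₀ hΓ] at h8
    exact h8.symm
  have hVT : ∀ t, 0 ≤ t → Commute V (T.op t) := by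
    intro t ht
    ext x
    obtain ⟨h1, h2⟩ := hcomm t ht ⟨Q x, hQ.mem_domain x⟩
    have h3 : T.op t (Q x) = Q (T.op t x) :=
      DFunLike.congr_fun (C0.Semigroup.op_commute_inverse hQ ht).eq x
    change V (T.op t x) = T.op t (V x)
    rw [hV _ (hQ.mem_domain _), hV x (hQ.mem_domain _)]
    simp only [h3] at h2
    exact h2
  -- Commutation is assumed for `C` only; `E` inherits it through `hVW` on the dense range of a
  -- power of `Q`.
  have hWT : ∀ t, 0 ≤ t → Commute W (T.op t) := by
    intro t ht
    refine C0.Semigroup.eq_of_mul_inverse_pow hM hQ (k := ⌊α⌋₊ + 1 + k) fun x => ?_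
    have h1 : T.op t ((Q ^ (⌊α⌋₊ + 1 + k)) x) = (Q ^ (⌊α⌋₊ + 1 + k)) (T.op t x) :=
      DFunLike.congr_fun ((C0.Semigroup.op_commute_inverse hQ ht).pow_right _).eq x
    have h2 : T.op t (J x) = J (T.op t x) :=
      DFunLike.congr_fun (C0.Semigroup.commute_fracInt hM hQ hk hd hγ0 hγ1 fun s hs =>
        T.op_commute ht hs).eq x
    have h3 : V (T.op t (J x)) = T.op t (V (J x)) := DFunLike.congr_fun (hVT t ht).eq (J x)
    change W (T.op t ((Q ^ (⌊α⌋₊ + 1 + k)) x)) = T.op t (W ((Q ^ (⌊α⌋₊ + 1 + k)) x))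
    rw [h2, hVW, hVW, map_smul] at h3
    rw [h1]
    exact smul_right_injective X hΓ h3
  -- As `Q (1 - z R) = R`, the operator `W (1 - z R)` is `E R(z, A)`, so this is the Weiss condition
  -- on `E`.
  have hWK : ∀ z : ℂ, 0 < z.re → ∀ x,
      ‖W ((1 - z • C0.res T.generator z) x)‖ ≤ K / z.re ^ (1 / 2 : ℝ) * ‖x‖ := by
    intro z hz x
    have hRQ : Commute Q (C0.res T.generator z) := C0.Semigroup.commute_res hM hz fun t ht =>
      (C0.Semigroup.op_commute_inverse hQ ht).symm
    have h1 : Q ((1 - z • C0.res T.generator z) x) = C0.res T.generator z x := by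
      have e : Q * (1 - z • C0.res T.generator z) = C0.res T.generator z := by
        rw [((Commute.one_right Q).sub_right (hRQ.smul_right z)).eq]
        exact hQ.one_sub_smul_mul (C0.Semigroup.isResolvent_res hM hz)
      exact DFunLike.congr_fun e x
    have h2 := hEK z hz x
    have h3 : (1 - ((2 : ℝ≥0∞)⁻¹).toReal : ℝ) = 1 / 2 := by norm_num
    rw [h3] at h2
    rw [hW _ (hQ.mem_domain _)]
    simp only [h1]
    exact h2
  obtain ⟨G, hG, B, ε, hε, hB, hTG⟩ :=
    C0.Semigroup.exists_factor hM hQ hc₀ hd₀ (one_div_pos.2 hα₀) hk hd hα hVW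
  have hex : ∀ t : ℝ, ∃ S : X →L[ℂ] X, 0 < t → (∀ x y, T.op t x = Q y → S x = V y) ∧
      ‖S‖ ≤ 4 * M ^ 2 * K * B * (t / 2) ^ (-(1 / 2 + ε)) := by
    intro t
    by_cases ht : 0 < t
    · obtain ⟨S, hS⟩ :=
        C0.Semigroup.exists_extension_of_factor hM hQ hVT hWT hK hWK hG hTG ht
      exact ⟨S, fun _ => hS⟩
    · exact ⟨0, fun h => absurd h ht⟩
  choose CT hCT using hex
  -- The square root halves the exponent, so `β = 2 ε` matches `t ^ (-(1 / 2 + ε))`. The power of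
  -- `2` comes from evaluating at `t / 2`, and `+ 1` makes the constant positive.
  refine ⟨CT, fun t ht x hx => ?_, 4 * M ^ 2 * K * B * 2 ^ (1 / 2 + ε) + 1, 2 * ε,
    by positivity, by positivity, fun t ht => ?_⟩
  · have h1 := hQ.eq_zero_apply ⟨T.op t x, hx⟩
    rw [(hCT t ht).1 x _ h1, hV _ (hQ.mem_domain _)]
    congr 1
    exact Subtype.ext h1.symm
  · have hsqrt : √(t ^ (1 + 2 * ε)) = t ^ (1 / 2 + ε) := by
      rw [Real.sqrt_eq_rpow, ← Real.rpow_mul ht.le]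
      ring_nf
    have hp : 0 < t ^ (1 / 2 + ε) := Real.rpow_pos_of_pos ht _
    rw [hsqrt, le_div_iff₀ hp]
    have h2 : (t / 2) ^ (-(1 / 2 + ε)) * t ^ (1 / 2 + ε) = 2 ^ (1 / 2 + ε) := by
      rw [Real.rpow_neg (by positivity), Real.div_rpow ht.le zero_le_two]
      field_simp
    calc ‖CT t‖ * t ^ (1 / 2 + ε)
        ≤ 4 * M ^ 2 * K * B * (t / 2) ^ (-(1 / 2 + ε)) * t ^ (1 / 2 + ε) := by
          gcongr
          exact (hCT t ht).2
      _ = 4 * M ^ 2 * K * B * 2 ^ (1 / 2 + ε) := by rw [mul_assoc, h2]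
      _ ≤ _ := by linarith
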